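/- Let $n\ge 2$. Let $e_1,\dots,e_n$ be the canonical basis of $\mathbb{R}^n$, let $J_n$ be the Jordan block $J_ne_i=e_{i-1}$ ($e_0=0$), let $\mathrm{sign}$ be the multivalued sign ($\mathrm{sign}(y)=y/|y|$ for $y\ne0$, $\mathrm{sign}(0)=[-1,1]$) and put $\lfloor y\rceil^a=|y|^a\,\mathrm{sign}(y)$ for $a>0$. Set $$p_i=1-\frac{i-1}{n}\ (1\le i\le n+1),\qquad \beta_i=\frac{n-1+i}{n-i}\ (0\le i\le n-1),\qquad \alpha=\frac{2(n-1)}{2n-1},$$ so that $\beta_0=p_2$. For positive constants $l_1,\dots,l_n$ define $v_0=0$, $$\omega_i=\lfloor x_i\rceil^{\beta_{i-1}}-\lfloor v_{i-1}\rceil^{\beta_{i-1}}\ (1\le i\le n),\qquad v_i=-l_i\lfloor\omega_i\rceil^{\frac{p_{i+1}}{p_i\beta_{i-1}}}\ (1\le i\le n-1),$$ $$V_n(x)=\sum_{i=1}^n W_i,\qquad W_i=\int_{v_{i-1}}^{x_i}\big(\lfloor s\rceil^{\beta_{i-1}}-\lfloor v_{i-1}\rceil^{\beta_{i-1}}\big)ds=\frac{|x_i|^{\beta_{i-1}+1}-|v_{i-1}|^{\beta_{i-1}+1}}{\beta_{i-1}+1}-\lfloor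 v_{i-1}\rceil^{\beta_{i-1}}(x_i-v_{i-1}).$$ Call positive constants $(l_1,\dots,l_n,c_n)$ admissible if the derivative of $V_n$ along $\dot x=J_nx+e_nu$ satisfies, for all $x\neq0$ and all $u\in\mathbb{R}$, $$\nabla V_n(x)\cdot(J_nx+e_nu)\le -c_nV_n^{\alpha}(x)+\omega_n(x)\big(u+l_n\,\mathrm{sign}(\omega_n(x))\big).$$ Theorem. Admissible constants exist. Moreover, for all admissible constants $(l_1,\dots,l_n,c_n)$, every $p\in[1,\infty]$, every $d\in L_p(\mathbb{R}_+)$ and every Filippov solution $x_d:\mathbb{R}_+\to\mathbb{R}^n$ of $$\dot x\in J_nx-l_ne_n\,\mathrm{sign}(\omega_n(x)+d)$$ the following holds. 1. If $p<\infty$ and $x_d(0)=0$, then $$\|V_n^\alpha(x_d)\|_p\le\frac{2l_n}{c_n}\|d\|_p;$$ moreover, with $\beta:=\alpha(p-1)$, $$\|V_n(x_d)\|_\infty\le\Big(\frac{(2l_n)^p(1+\beta)}{c_n^{p-1}}\Big)^{\frac1{1+\beta}}\|d\|_p^{\frac p{1+\beta}},$$ and $x_d(t)\to0$ as $t\to\infty$.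 2. If $p=\infty$ (and $x_d(0)\in\mathbb{R}^n$ is arbitrary), then $$\limsup_{s\to\infty}V_n^\alpha(x_d(s))\le\frac{2l_n}{c_n}\|d\|_\infty .$$ -/

import Mathlib

open MeasureTheory Filter Topology Set
open scoped ENNReal

noncomputable section

namespace SignFeedback

/-- The weights `p_i = 1 - (i - 1) / n`. -/
def wt (n i : ℕ) : ℝ := 1 - ((i : ℝ) - 1) / n

/-- The exponents `β_i = (n - 1 + i) / (n - i)`, `0 ≤ i ≤ n - 1`.  For `i = 0` the formula gives
`β_0 = (n - 1) / n = p_2`. -/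
def beta (n i : ℕ) : ℝ := ((n : ℝ) - 1 + i) / ((n : ℝ) - i)

/-- The exponent `α = 2 (n - 1) / (2 n - 1)`. -/
def alpha (n : ℕ) : ℝ := 2 * ((n : ℝ) - 1) / (2 * (n : ℝ) - 1)

/-- The signed power `⌊y⌉ ^ a = |y| ^ a * sign y`; it is used below only with `a > 0`, where its
value at `y = 0` is `0`. -/
def spow (a y : ℝ) : ℝ := |y| ^ a * Real.sign y

/-- The multivalued sign: `y / |y|` for `y ≠ 0` and `[-1, 1]` for `y = 0`. -/
def signSet (y : ℝ) : Set ℝ := {s | (y ≠ 0 ∧ s = y / |y|) ∨ (y = 0 ∧ s ∈ Icc (-1 : ℝ) 1)}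

/-- The coordinates `x_1, …, x_n` of `x ∈ ℝⁿ`, numbered from `1`. -/
def coord {n : ℕ} (x : Fin n → ℝ) (i : ℕ) : ℝ :=
  if h : 1 ≤ i ∧ i ≤ n then x ⟨i - 1, by omega⟩ else 0

/-- The functions `v_0 = 0` and `v_i = - l_i ⌊ω_i⌉ ^ (p_{i+1} / (p_i β_{i-1}))`, where
`ω_i = ⌊x_i⌉ ^ β_{i-1} - ⌊v_{i-1}⌉ ^ β_{i-1}` (they are used below for `i ≤ n - 1`). -/
def v (n : ℕ) (l : ℕ → ℝ) (x : Fin n → ℝ) : ℕ → ℝ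
  | 0 => 0
  | i + 1 => -l (i + 1) *
      spow (wt n (i + 2) / (wt n (i + 1) * beta n i))
        (spow (beta n i) (coord x (i + 1)) - spow (beta n i) (v n l x i))

/-- `ω_i = ⌊x_i⌉ ^ β_{i-1} - ⌊v_{i-1}⌉ ^ β_{i-1}` for `1 ≤ i ≤ n`. -/
def omega (n : ℕ) (l : ℕ → ℝ) (x : Fin n → ℝ) (i : ℕ) : ℝ :=
  spow (beta n (i - 1)) (coord x i) - spow (beta n (i - 1)) (v n l x (i - 1))

/-- `W_i`, the integral of `⌊s⌉ ^ β_{i-1} - ⌊v_{i-1}⌉ ^ β_{i-1}` over `s` from `v_{i-1}` to `x_i`,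
in closed form, for `1 ≤ i ≤ n`. -/
def W (n : ℕ) (l : ℕ → ℝ) (x : Fin n → ℝ) (i : ℕ) : ℝ :=
  (|coord x i| ^ (beta n (i - 1) + 1) - |v n l x (i - 1)| ^ (beta n (i - 1) + 1))
      / (beta n (i - 1) + 1)
    - spow (beta n (i - 1)) (v n l x (i - 1)) * (coord x i - v n l x (i - 1))

/-- The Lyapunov function `V_n = W_1 + ⋯ + W_n`. -/
def V (n : ℕ) (l : ℕ → ℝ) (x : Fin n → ℝ) : ℝ := ∑ i ∈ Finset.Icc 1 n, W n l x i

/-- The Jordan block `J_n`, with `J_n e_i = e_{i-1}`; thus `(J_n x)_i = x_{i+1}` and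
`(J_n x)_n = 0`. -/
def jordan (n : ℕ) : Matrix (Fin n) (Fin n) ℝ :=
  Matrix.of fun i j => if (j : ℕ) = (i : ℕ) + 1 then 1 else 0

/-- The last vector `e_n` of the canonical basis. -/
def lastVec (n : ℕ) : Fin n → ℝ := fun i => if (i : ℕ) + 1 = n then 1 else 0

/-- The multivalued right-hand side `J_n x - l_n e_n sign (ω_n(x) + d)`, for a value `d` of the
disturbance. -/
def rhs (n : ℕ) (l : ℕ → ℝ) (d : ℝ) (x : Fin n → ℝ) : Set (Fin n → ℝ) :=
  {w | ∃ s ∈ signSet (omega n l x n + d), w = (jordan n).mulVec x - (l n * s) • lastVec n}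

/-- The Filippov regularization of a (possibly multivalued) vector field `F` on `ℝⁿ`: the
intersection, over all `δ > 0` and all Lebesgue-null sets `N`, of the closed convex hulls of the
values of `F` on `B(x, δ) \ N`. -/
def filippov {n : ℕ} (F : (Fin n → ℝ) → Set (Fin n → ℝ)) (x : Fin n → ℝ) : Set (Fin n → ℝ) :=
  ⋂ (δ : ℝ) (_ : 0 < δ) (N : Set (Fin n → ℝ)) (_ : volume N = 0),
    closure (convexHull ℝ (⋃ y ∈ Metric.ball x δ \ N, F y))

/-- Filippov solutions on `[0, ∞)` of `x' = F(t, x)`: locally absolutely continuous curves whose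
derivative lies, for almost every time, in the Filippov regularization of `F(t, ·)` at `x(t)`. -/
def IsFilippovSolution {n : ℕ} (F : ℝ → (Fin n → ℝ) → Set (Fin n → ℝ)) (x : ℝ → Fin n → ℝ) :
    Prop :=
  (∀ T : ℝ, 0 ≤ T → AbsolutelyContinuousOnInterval x 0 T) ∧
    ∀ᵐ t ∂(volume.restrict (Ici (0 : ℝ))), ∃ w ∈ filippov (F t) (x t), HasDerivAt x w t

/-- Positive constants `l_1, …, l_n` and `c_n` for which the derivative of `V_n` along
`x' = J_n x + e_n u` satisfies, away from the origin and for every value `u` of the control,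
`dV_n/dt ≤ - c_n V_n ^ α + ω_n (u + l_n sign ω_n)`. -/
def Admissible (n : ℕ) (l : ℕ → ℝ) (c : ℝ) : Prop :=
  (∀ i, 1 ≤ i → i ≤ n → 0 < l i) ∧ 0 < c ∧
    ∀ x : Fin n → ℝ, x ≠ 0 → ∀ u : ℝ, ∀ s ∈ signSet (omega n l x n),
      fderiv ℝ (V n l) x ((jordan n).mulVec x + u • lastVec n) ≤
        -c * V n l x ^ alpha n + omega n l x n * (u + l n * s)

/-- Lebesgue measure on `ℝ₊ = [0, ∞)`. -/
def mu : Measure ℝ := volume.restrict (Ici 0)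

end SignFeedback

end

open SignFeedback

namespace SignFeedback

/-! Homogeneity and compactness give the gains. Under the dilation x_i ↦ r^{p_i} x_i every W_i has
degree (2n-1)/n, the field J_n x has degree -1/n, and V_n^α has exactly the degree of the derivative
of V_n along J_n x. Strict inequalities between functions of equal degree therefore need proof only
on the unit sphere.

The gains are found by backstepping. Where ω_{k+1} = 0, the function W_{k+1} is minimal, so its
differential vanishes, and x_{k+1} equals the virtual control v_k; the derivative of W_1 + ⋯ +
W_{k+1} is then that of the previous stage, which is negative. Elsewhere a large multiple of a power
of |ω_{k+1}| compensates (`exists_pos_forall_sub_mul_neg`, `exists_gain`). At the last stage this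
power is 1, the feedback is a sign, and one more compactness argument yields c_n
(`exists_admissible`).

For the disturbed system, Filippov regularization adds no velocities (`filippov_rhs_subset`), and
sign(ω_n + d) can differ from sign(ω_n) only where |ω_n| ≤ |d|, at a cost of at most 2 l_n |d|.
Hence φ = V_n(x_d) satisfies φ' ≤ -c_n φ^α + 2 l_n |d| almost everywhere
(`Admissible.isDissipative`). The rest is scalar: multiplying by φ^{α(p-1)}, using Young's
inequality and integrating (`IsDissipative.energy_le`) gives both norm bounds and the convergence;
for p = ∞, φ decreases at a definite rate above any level exceeding the claimed one
(`IsDissipative.eventually_rpow_le`). -/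

/-! ### Signed powers -/

theorem spow_zero (a : ℝ) : spow a 0 = 0 := by simp [spow]

theorem spow_neg (a y : ℝ) : spow a (-y) = -spow a y := by
  simp [spow, Real.sign_neg]

theorem spow_of_pos (a : ℝ) {y : ℝ} (hy : 0 < y) : spow a y = y ^ a := by
  simp [spow, abs_of_pos hy, Real.sign_of_pos hy]

theorem spow_of_neg (a : ℝ) {y : ℝ} (hy : y < 0) : spow a y = -(-y) ^ a := by
  simp [spow, abs_of_neg hy, Real.sign_of_neg hy]

theorem spow_one (y : ℝ) : spow 1 y = y := by
  rcases lt_trichotomy y 0 with h | rfl | h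
  · simp [spow_of_neg _ h]
  · exact spow_zero _
  · simp [spow_of_pos _ h]

theorem spow_mul_of_pos (a : ℝ) {c : ℝ} (hc : 0 < c) (y : ℝ) :
    spow a (c * y) = c ^ a * spow a y := by
  rcases lt_trichotomy y 0 with h | rfl | h
  · rw [spow_of_neg _ h, spow_of_neg _ (mul_neg_of_pos_of_neg hc h), ← mul_neg,
      Real.mul_rpow hc.le (by linarith)]
    ring
  · simp [spow_zero]
  · rw [spow_of_pos _ h, spow_of_pos _ (mul_pos hc h), Real.mul_rpow hc.le h.le]

theorem spow_rpow_mul {r : ℝ} (hr : 0 < r) (q a y : ℝ) :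
    spow a (r ^ q * y) = r ^ (q * a) * spow a y := by
  rw [spow_mul_of_pos _ (Real.rpow_pos_of_pos hr q), ← Real.rpow_mul hr.le]

theorem spow_spow (a b y : ℝ) : spow a (spow b y) = spow (b * a) y := by
  rcases lt_trichotomy y 0 with h | rfl | h
  · have h' : 0 < (-y) ^ b := Real.rpow_pos_of_pos (by linarith) _
    rw [spow_of_neg b h, spow_neg, spow_of_pos a h', spow_of_neg _ h, Real.rpow_mul (by linarith)]
  · simp [spow_zero]
  · rw [spow_of_pos b h, spow_of_pos a (Real.rpow_pos_of_pos h _), spow_of_pos _ h,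
      Real.rpow_mul h.le]

theorem abs_spow {a : ℝ} (ha : a ≠ 0) (y : ℝ) : |spow a y| = |y| ^ a := by
  rcases lt_trichotomy y 0 with h | rfl | h
  · rw [spow_of_neg _ h, abs_neg, abs_of_neg h, abs_of_nonneg (Real.rpow_nonneg (by linarith) _)]
  · simp [spow_zero, Real.zero_rpow ha]
  · rw [spow_of_pos _ h, abs_of_pos h, abs_of_nonneg (Real.rpow_nonneg h.le _)]

theorem spow_mul_self {a : ℝ} (ha : 0 < a) (y : ℝ) : spow a y * y = |y| ^ (a + 1) := by
  rcases lt_trichotomy y 0 with h | rfl | h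
  · rw [spow_of_neg _ h, abs_of_neg h, Real.rpow_add_one (by linarith)]
    ring
  · simp [Real.zero_rpow (by linarith : a + 1 ≠ 0)]
  · rw [spow_of_pos _ h, abs_of_pos h, Real.rpow_add_one h.ne']

theorem spow_eq_max {a : ℝ} (ha : 0 < a) (y : ℝ) :
    spow a y = max y 0 ^ a - max (-y) 0 ^ a := by
  rcases lt_trichotomy y 0 with h | rfl | h
  · rw [spow_of_neg _ h, max_eq_right h.le, max_eq_left (by linarith), Real.zero_rpow ha.ne']
    ring
  · simp [spow_zero]
  · rw [spow_of_pos _ h, max_eq_left h.le, max_eq_right (by linarith), Real.zero_rpow ha.ne']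
    ring

theorem continuous_spow {a : ℝ} (ha : 0 < a) : Continuous (spow a) := by
  have : spow a = fun y => max y 0 ^ a - max (-y) 0 ^ a := funext (spow_eq_max ha)
  rw [this]
  exact ((continuous_id.max continuous_const).rpow_const fun _ => Or.inr ha.le).sub
    ((continuous_neg.max continuous_const).rpow_const fun _ => Or.inr ha.le)

theorem spow_injective {a : ℝ} (ha : 0 < a) : Function.Injective (spow a) := by
  intro x y h
  have := congrArg (spow a⁻¹) h
  rwa [spow_spow, spow_spow, mul_inv_cancel₀ ha.ne', spow_one, spow_one] at this

theorem spow_strictMono {a : ℝ} (ha : 0 < a) : StrictMono (spow a) := by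
  refine Monotone.strictMono_of_injective (fun x y h => ?_) (spow_injective ha)
  rw [spow_eq_max ha, spow_eq_max ha]
  gcongr

theorem hasDerivAt_abs_rpow_add_one {b : ℝ} (hb : 0 < b) (y : ℝ) :
    HasDerivAt (fun y => |y| ^ (b + 1)) ((b + 1) * spow b y) y := by
  convert hasDerivAt_abs_rpow y (by linarith : 1 < b + 1) using 1
  rw [mul_assoc]
  congr 1
  rcases lt_trichotomy y 0 with h | rfl | h
  · rw [spow_of_neg _ h, abs_of_neg h]
    have : (-y) ^ b = (-y) ^ (b + 1 - 2) * (-y) := by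
      rw [← Real.rpow_add_one (by linarith)]; congr 1; ring
    rw [this]; ring
  · simp [spow_zero]
  · rw [spow_of_pos _ h, abs_of_pos h, ← Real.rpow_add_one h.ne']; congr 1; ring

theorem hasDerivAt_spow {a : ℝ} (ha : 1 < a) (y : ℝ) :
    HasDerivAt (spow a) (a * |y| ^ (a - 1)) y := by
  have key : ∀ y : ℝ, y ≠ 0 → HasDerivAt (spow a) (a * |y| ^ (a - 1)) y := by
    intro y hy
    rcases lt_or_gt_of_ne hy with h | h
    · have h1 : HasDerivAt (fun y : ℝ => -(-y) ^ a) (-(-1 * a * (-y) ^ (a - 1))) y :=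
        ((hasDerivAt_neg y).rpow_const (Or.inr ha.le)).neg
      rw [abs_of_neg h]
      refine (h1.congr_of_eventuallyEq ?_).congr_deriv (by ring)
      filter_upwards [Iio_mem_nhds h] with z hz using spow_of_neg a hz
    · rw [abs_of_pos h]
      refine (Real.hasDerivAt_rpow_const (Or.inr ha.le)).congr_of_eventuallyEq ?_
      filter_upwards [Ioi_mem_nhds h] with z hz using spow_of_pos a hz
  rcases eq_or_ne y 0 with rfl | hy
  -- At the origin the derivative is obtained as the limit of the derivatives at nearby points.
  · exact hasDerivAt_of_hasDerivAt_of_ne (g := fun y => a * |y| ^ (a - 1)) (fun z hz => key z hz)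
      (continuous_spow (by linarith)).continuousAt
      (continuous_const.mul
        (continuous_abs.rpow_const fun _ => Or.inr (by linarith))).continuousAt
  · exact key y hy

theorem contDiff_spow {a : ℝ} (ha : 1 < a) : ContDiff ℝ 1 (spow a) := by
  rw [contDiff_one_iff_deriv]
  refine ⟨fun y => (hasDerivAt_spow ha y).differentiableAt, ?_⟩
  rw [show deriv (spow a) = fun y => a * |y| ^ (a - 1) from
    funext fun y => (hasDerivAt_spow ha y).deriv]
  exact continuous_const.mul (continuous_abs.rpow_const fun _ => Or.inr (by linarith))

theorem contDiff_abs_rpow {a : ℝ} (ha : 1 < a) : ContDiff ℝ 1 (fun y : ℝ => |y| ^ a) :=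
  contDiff_norm_rpow (E := ℝ) ha

/-- Strict convexity of `|x| ^ (b + 1)`, as the gap between the function and its tangent. -/
theorem tangent_gap_pos {b : ℝ} (hb : 0 < b) {w x : ℝ} (h : x ≠ w) :
    0 < (|x| ^ (b + 1) - |w| ^ (b + 1)) / (b + 1) - spow b w * (x - w) := by
  set g : ℝ → ℝ := fun x => (|x| ^ (b + 1) - |w| ^ (b + 1)) / (b + 1) - spow b w * (x - w) with hg
  have hd : ∀ x, HasDerivAt g (spow b x - spow b w) x := by
    intro x
    have h1 := (((hasDerivAt_abs_rpow_add_one hb x).sub_const (|w| ^ (b + 1))).div_const (b + 1)).sub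
      (((hasDerivAt_id x).sub_const w).const_mul (spow b w))
    refine h1.congr_deriv ?_
    field_simp
  have hc : Continuous g := continuous_iff_continuousAt.2 fun x => (hd x).continuousAt
  have hw : g w = 0 := by simp [hg]
  rw [← hw]
  rcases lt_or_gt_of_ne h with h | h
  · refine strictAntiOn_of_deriv_neg (convex_Iic w) hc.continuousOn (fun y hy => ?_) h.le
      self_mem_Iic h
    rw [interior_Iic] at hy
    rw [(hd y).deriv]
    linarith [spow_strictMono hb hy]
  · refine strictMonoOn_of_deriv_pos (convex_Ici w) hc.continuousOn (fun y hy => ?_)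
      self_mem_Ici h.le h
    rw [interior_Ici] at hy
    rw [(hd y).deriv]
    linarith [spow_strictMono hb hy]

/-- Young's form of the gap: `w` enters only through `spow b w`. This matters because the virtual
controls need not be differentiable, whereas their signed powers are C¹. -/
theorem tangent_gap_eq {b : ℝ} (hb : 0 < b) (w x : ℝ) :
    (|x| ^ (b + 1) - |w| ^ (b + 1)) / (b + 1) - spow b w * (x - w) =
      |x| ^ (b + 1) / (b + 1) + b / (b + 1) * |spow b w| ^ ((b + 1) / b) - spow b w * x := by
  rw [abs_spow hb.ne', ← Real.rpow_mul (abs_nonneg w), mul_div_cancel₀ _ hb.ne', mul_sub,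
    spow_mul_self hb]
  field_simp
  ring

/-- The exponent `p_{i+2} / (p_{i+1} β_i)` of the virtual control `v_{i+1}`. -/
noncomputable def kap (n i : ℕ) : ℝ := wt n (i + 2) / (wt n (i + 1) * beta n i)

/-- The homogeneity degree of the Lyapunov function. -/
noncomputable def deg (n : ℕ) : ℝ := (2 * (n : ℝ) - 1) / n

/-! ### Arithmetic of the exponents -/

section exponents

variable {n : ℕ} (hn : 2 ≤ n)
include hn

theorem two_le_cast : (2 : ℝ) ≤ n := by exact_mod_cast hn

theorem wt_succ (i : ℕ) : wt n (i + 1) = ((n : ℝ) - i) / n := by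
  have := two_le_cast hn
  unfold wt
  push_cast
  field_simp
  ring

theorem wt_pos {i : ℕ} (hi : i ≤ n) : 0 < wt n i := by
  have := two_le_cast hn
  have hi' : (i : ℝ) ≤ n := by exact_mod_cast hi
  have : ((i : ℝ) - 1) / n < 1 := by rw [div_lt_one (by linarith)]; linarith
  unfold wt
  linarith

theorem beta_pos {i : ℕ} (hi : i < n) : 0 < beta n i := by
  have := two_le_cast hn
  have hi' : (i : ℝ) < n := by exact_mod_cast hi
  have : (0 : ℝ) ≤ i := i.cast_nonneg
  exact div_pos (by linarith) (by linarith)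

omit hn in
theorem one_lt_beta {i : ℕ} (h1 : 1 ≤ i) (hi : i < n) : 1 < beta n i := by
  have hi' : (i : ℝ) < n := by exact_mod_cast hi
  have : (1 : ℝ) ≤ i := by exact_mod_cast h1
  unfold beta
  rw [one_lt_div (by linarith)]
  linarith

theorem wt_mul_beta {i : ℕ} (hi : i < n) : wt n (i + 1) * beta n i = ((n : ℝ) - 1 + i) / n := by
  have := two_le_cast hn
  have hi' : (i : ℝ) < n := by exact_mod_cast hi
  have : (n : ℝ) - i ≠ 0 := by linarith
  rw [wt_succ hn, beta]
  field_simp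

theorem wt_mul_beta_pos {i : ℕ} (hi : i < n) : 0 < wt n (i + 1) * beta n i :=
  mul_pos (wt_pos hn hi) (beta_pos hn hi)

theorem kap_eq {i : ℕ} (hi : i < n) : kap n i = ((n : ℝ) - i - 1) / ((n : ℝ) - 1 + i) := by
  have := two_le_cast hn
  have : (0 : ℝ) ≤ i := i.cast_nonneg
  have : (n : ℝ) - 1 + i ≠ 0 := by linarith
  rw [kap, wt_mul_beta hn hi, wt_succ hn (i + 1)]
  push_cast
  field_simp
  ring

theorem kap_nonneg {i : ℕ} (hi : i < n) : 0 ≤ kap n i := by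
  have := two_le_cast hn
  have hi' : (i : ℝ) + 1 ≤ n := by exact_mod_cast hi
  have : (0 : ℝ) ≤ i := i.cast_nonneg
  rw [kap_eq hn hi]
  exact div_nonneg (by linarith) (by linarith)

theorem kap_pos {i : ℕ} (hi : i + 1 < n) : 0 < kap n i := by
  have := two_le_cast hn
  have hi' : (i : ℝ) + 1 < n := by exact_mod_cast hi
  have : (0 : ℝ) ≤ i := i.cast_nonneg
  rw [kap_eq hn (by omega)]
  exact div_pos (by linarith) (by linarith)

theorem wt_mul_beta_mul_kap {i : ℕ} (hi : i < n) :
    wt n (i + 1) * beta n i * kap n i = wt n (i + 2) :=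
  mul_div_cancel₀ _ (wt_mul_beta_pos hn hi).ne'

/-- The exponent carried by ω_{i+1} in ⌊v_{i+1}⌉^{β_{i+1}}; its being larger than 1 is the source of
smoothness. -/
theorem kap_mul_beta {i : ℕ} (hi : i + 1 < n) :
    kap n i * beta n (i + 1) = ((n : ℝ) + i) / ((n : ℝ) - 1 + i) := by
  have := two_le_cast hn
  have hi' : (i : ℝ) + 1 < n := by exact_mod_cast hi
  have : (0 : ℝ) ≤ i := i.cast_nonneg
  have h1 : (n : ℝ) - 1 + i ≠ 0 := by linarith
  have h2 : (n : ℝ) - i - 1 ≠ 0 := by linarith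
  have h3 : (n : ℝ) - (i + 1) ≠ 0 := by linarith
  rw [kap_eq hn (by omega), beta]
  push_cast
  field_simp
  ring

/-- Independence of `i` is the point: all W_i get a common degree. -/
theorem wt_mul_beta_add_one {i : ℕ} (hi : i < n) : wt n (i + 1) * (beta n i + 1) = deg n := by
  have := two_le_cast hn
  rw [mul_add, wt_mul_beta hn hi, wt_succ hn, deg]
  field_simp
  ring

theorem deg_pos : 0 < deg n := by
  have := two_le_cast hn
  exact div_pos (by linarith) (by linarith)

theorem alpha_pos : 0 < alpha n := by
  have := two_le_cast hn
  exact div_pos (by linarith) (by linarith)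

/-- This identity fixes α: V_n^α must scale like the derivative of V_n along a field of degree -1/n.
-/
theorem deg_mul_alpha : deg n * alpha n = deg n - 1 / n := by
  have := two_le_cast hn
  have h : 2 * (n : ℝ) - 1 ≠ 0 := by linarith
  unfold deg alpha
  field_simp
  ring

theorem wt_mul_beta_mul_kap_add_one {i : ℕ} (hi : i < n) :
    wt n (i + 1) * beta n i * (kap n i + 1) = deg n - 1 / n := by
  have := two_le_cast hn
  rw [mul_add, wt_mul_beta_mul_kap hn hi, wt_mul_beta hn hi, wt_succ hn (i + 1), deg]
  push_cast
  field_simp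
  ring

/-- The last feedback exponent degenerates to 0, so the final control is a pure sign. -/
theorem kap_last {i : ℕ} (hi : i + 1 = n) : kap n i = 0 := by
  rw [kap_eq hn (by omega)]
  have : (i : ℝ) + 1 = n := by exact_mod_cast hi
  rw [show (n : ℝ) - i - 1 = 0 by linarith, zero_div]

end exponents

/-! ### Coordinates numbered from 1 and the integrator chain -/

section coordinates

variable {n : ℕ}

theorem coord_succ (x : Fin n → ℝ) {i : ℕ} (hi : i < n) : coord x (i + 1) = x ⟨i, hi⟩ :=
  dif_pos ⟨by omega, by omega⟩

theorem coord_of_lt (x : Fin n → ℝ) {i : ℕ} (hi : n < i) : coord x i = 0 :=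
  dif_neg (by omega)

theorem ext_coord {x y : Fin n → ℝ} (h : ∀ i < n, coord x (i + 1) = coord y (i + 1)) : x = y := by
  ext ⟨i, hi⟩
  simpa [coord_succ _ hi] using h i hi

theorem coord_zero_vec (i : ℕ) : coord (0 : Fin n → ℝ) i = 0 := by
  unfold coord
  split_ifs <;> rfl

theorem coord_add (x y : Fin n → ℝ) (i : ℕ) : coord (x + y) i = coord x i + coord y i := by
  unfold coord
  split_ifs <;> simp

theorem coord_smul (c : ℝ) (x : Fin n → ℝ) (i : ℕ) : coord (c • x) i = c * coord x i := by
  unfold coord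
  split_ifs <;> simp

theorem contDiff_coord (i : ℕ) : ContDiff ℝ 1 fun x : Fin n → ℝ => coord x i := by
  unfold coord
  split_ifs <;> fun_prop

/-- The canonical basis vector `e_k`, numbered from `1` (and `0` for other `k`). -/
def basisVec (n k : ℕ) : Fin n → ℝ := fun i => if (i : ℕ) + 1 = k then 1 else 0

theorem lastVec_eq : lastVec n = basisVec n n := rfl

theorem coord_basisVec (k : ℕ) {i : ℕ} (hi : i < n) :
    coord (basisVec n k) (i + 1) = if i + 1 = k then 1 else 0 := by
  rw [coord_succ _ hi]
  rfl

theorem coord_basisVec_of_ne {k i : ℕ} (h : i ≠ k) : coord (basisVec n k) i = 0 := by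
  unfold coord
  split_ifs with h1
  · simp only [basisVec]
    rw [if_neg (by omega)]
  · rfl

theorem coord_jordan (x : Fin n → ℝ) {i : ℕ} (hi : i < n) :
    coord ((jordan n).mulVec x) (i + 1) = coord x (i + 2) := by
  rw [coord_succ _ hi]
  simp only [jordan, Matrix.mulVec, dotProduct, Matrix.of_apply, ite_mul, one_mul, zero_mul]
  by_cases h : i + 1 < n
  · rw [coord_succ _ h, Finset.sum_eq_single ⟨i + 1, h⟩]
    · simp
    · intro j _ hj
      rw [if_neg]
      intro hj'
      exact hj (Fin.ext hj')
    · simp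
  · rw [coord_of_lt _ (by omega)]
    refine Finset.sum_eq_zero fun j _ => ?_
    rw [if_neg]
    have := j.isLt
    omega

end coordinates

/-! ### The Lyapunov function: dependence, positivity, smoothness -/

section lyapunov

variable {n : ℕ} {l : ℕ → ℝ}

theorem v_succ (l : ℕ → ℝ) (x : Fin n → ℝ) (i : ℕ) :
    v n l x (i + 1) = -l (i + 1) * spow (kap n i) (omega n l x (i + 1)) := rfl

theorem omega_succ (l : ℕ → ℝ) (x : Fin n → ℝ) (i : ℕ) :
    omega n l x (i + 1) = spow (beta n i) (coord x (i + 1)) - spow (beta n i) (v n l x i) := rfl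

theorem W_succ (l : ℕ → ℝ) (x : Fin n → ℝ) (i : ℕ) :
    W n l x (i + 1) = (|coord x (i + 1)| ^ (beta n i + 1) - |v n l x i| ^ (beta n i + 1))
      / (beta n i + 1) - spow (beta n i) (v n l x i) * (coord x (i + 1) - v n l x i) := rfl

/-- The triangular structure: a gain can be changed later without affecting the earlier stages of
the construction. -/
theorem v_congr {l l' : ℕ → ℝ} {x y : Fin n → ℝ} {k : ℕ} (hl : ∀ i ≤ k, l i = l' i)
    (h : ∀ i ≤ k, coord x i = coord y i) : v n l x k = v n l' y k := by
  induction k with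
  | zero => rfl
  | succ k ih =>
    rw [v_succ, v_succ, omega_succ, omega_succ, hl _ le_rfl, h _ le_rfl,
      ih (fun i hi => hl i (by omega)) fun i hi => h i (by omega)]

theorem omega_congr {l l' : ℕ → ℝ} {x y : Fin n → ℝ} {k : ℕ} (hl : ∀ i ≤ k, l i = l' i)
    (h : ∀ i ≤ k + 1, coord x i = coord y i) : omega n l x (k + 1) = omega n l' y (k + 1) := by
  rw [omega_succ, omega_succ, h _ le_rfl, v_congr hl fun i hi => h i (by omega)]

theorem W_congr {l l' : ℕ → ℝ} {x y : Fin n → ℝ} {k : ℕ} (hl : ∀ i ≤ k, l i = l' i)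
    (h : ∀ i ≤ k + 1, coord x i = coord y i) : W n l x (k + 1) = W n l' y (k + 1) := by
  rw [W_succ, W_succ, h _ le_rfl, v_congr hl fun i hi => h i (by omega)]

/-- The partial sum `W_1 + ⋯ + W_k` of the Lyapunov function. -/
noncomputable def partialV (n : ℕ) (l : ℕ → ℝ) (k : ℕ) (x : Fin n → ℝ) : ℝ :=
  ∑ i ∈ Finset.range k, W n l x (i + 1)

theorem V_eq_partialV (l : ℕ → ℝ) : V n l = partialV n l n := by
  ext x
  unfold V partialV
  rw [Finset.range_eq_Ico, Finset.sum_Ico_add' (fun i => W n l x i) 0 n 1]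
  rfl

theorem partialV_succ (l : ℕ → ℝ) (k : ℕ) (x : Fin n → ℝ) :
    partialV n l (k + 1) x = partialV n l k x + W n l x (k + 1) :=
  Finset.sum_range_succ _ _

theorem partialV_congr {l l' : ℕ → ℝ} {x y : Fin n → ℝ} {k : ℕ} (hl : ∀ i < k, l i = l' i)
    (h : ∀ i ≤ k, coord x i = coord y i) : partialV n l k x = partialV n l' k y := by
  refine Finset.sum_congr rfl fun i hi => ?_
  rw [Finset.mem_range] at hi
  exact W_congr (fun j hj => hl j (by omega)) fun j hj => h j (by omega)

section smooth

variable (hn : 2 ≤ n)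
include hn

theorem W_nonneg (l : ℕ → ℝ) (x : Fin n → ℝ) {i : ℕ} (hi : i < n) : 0 ≤ W n l x (i + 1) := by
  rw [W_succ]
  by_cases h : coord x (i + 1) = v n l x i
  · simp [h]
  · exact (tangent_gap_pos (beta_pos hn hi) h).le

theorem W_eq_zero_iff (l : ℕ → ℝ) (x : Fin n → ℝ) {i : ℕ} (hi : i < n) :
    W n l x (i + 1) = 0 ↔ coord x (i + 1) = v n l x i := by
  rw [W_succ]
  refine ⟨fun h => ?_, fun h => by simp [h]⟩
  by_contra h'
  exact (tangent_gap_pos (beta_pos hn hi) h').ne' h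

theorem omega_eq_zero_iff (l : ℕ → ℝ) (x : Fin n → ℝ) {i : ℕ} (hi : i < n) :
    omega n l x (i + 1) = 0 ↔ coord x (i + 1) = v n l x i := by
  rw [omega_succ, sub_eq_zero]
  exact (spow_injective (beta_pos hn hi)).eq_iff

omit hn in
theorem v_eq_zero {x : Fin n → ℝ} {k : ℕ} (h : ∀ i ≤ k, coord x i = 0) : v n l x k = 0 := by
  induction k with
  | zero => rfl
  | succ k ih =>
    rw [v_succ, omega_succ, h _ le_rfl, ih fun i hi => h i (by omega), sub_self, spow_zero,
      mul_zero]

theorem V_nonneg (l : ℕ → ℝ) (x : Fin n → ℝ) : 0 ≤ V n l x := by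
  rw [V_eq_partialV]
  exact Finset.sum_nonneg fun i hi => W_nonneg hn l x (Finset.mem_range.1 hi)

theorem V_zero (l : ℕ → ℝ) : V n l 0 = 0 := by
  rw [V_eq_partialV]
  refine Finset.sum_eq_zero fun i hi => ?_
  rw [W_eq_zero_iff hn _ _ (Finset.mem_range.1 hi), coord_zero_vec,
    v_eq_zero fun i _ => coord_zero_vec i]

/-- If all W_i vanish, then x_i = v_{i-1} and ω_i = 0 for every i; hence all v_i vanish, and the
coordinates with them. -/
theorem eq_zero_of_V_eq_zero {x : Fin n → ℝ} (h : V n l x = 0) : x = 0 := by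
  rw [V_eq_partialV, partialV, Finset.sum_eq_zero_iff_of_nonneg
    fun i hi => W_nonneg hn l x (Finset.mem_range.1 hi)] at h
  have h1 : ∀ i < n, coord x (i + 1) = v n l x i := fun i hi =>
    (W_eq_zero_iff hn l x hi).1 (h i (Finset.mem_range.2 hi))
  refine ext_coord fun i hi => ?_
  rw [h1 i hi, coord_zero_vec]
  cases i with
  | zero => rfl
  | succ i =>
    rw [v_succ, (omega_eq_zero_iff hn l x (by omega)).2 (h1 i (by omega)), spow_zero, mul_zero]

theorem V_pos {x : Fin n → ℝ} (h : x ≠ 0) : 0 < V n l x :=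
  (V_nonneg hn l x).lt_of_ne' fun h' => h (eq_zero_of_V_eq_zero hn h')

variable (hl : ∀ i, 1 ≤ i → i ≤ n → 0 < l i)
include hl

/-- The outer power β_i lifts the small exponent of v_i: ⌊v_i⌉^{β_i} is a constant times a signed
power of ω_i with exponent greater than 1. -/
theorem contDiff_spow_v {i : ℕ} (hi : i < n) :
    ContDiff ℝ 1 fun x : Fin n → ℝ => spow (beta n i) (v n l x i) := by
  induction i with
  | zero =>
    simp only [v, spow_zero]
    exact contDiff_const
  | succ i ih =>
    have h2 := two_le_cast hn
    have hi0 : (0 : ℝ) ≤ i := i.cast_nonneg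
    have hform : (fun x : Fin n → ℝ => spow (beta n (i + 1)) (v n l x (i + 1))) = fun x =>
        -(l (i + 1) ^ beta n (i + 1) *
          spow (kap n i * beta n (i + 1)) (omega n l x (i + 1))) := by
      funext x
      rw [v_succ, neg_mul, spow_neg, spow_mul_of_pos _ (hl _ (by omega) hi.le), spow_spow]
    rw [hform]
    refine (contDiff_const.mul ?_).neg
    cases i with
    | zero =>
      -- Here ω_1 = ⌊x_1⌉^{β_0} with β_0 < 1 is not C¹, so the exponents must be combined first;
      -- their product is exactly 1.
      have : ∀ x : Fin n → ℝ, spow (kap n 0 * beta n 1) (omega n l x 1) = coord x 1 := by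
        intro x
        rw [show omega n l x 1 = spow (beta n 0) (coord x 1) - spow (beta n 0) 0 from rfl,
          spow_zero, sub_zero, spow_spow, kap_mul_beta hn hi, beta]
        push_cast
        rw [show ((n : ℝ) - 1 + 0) / (n - 0) * ((n + 0) / (n - 1 + 0)) = 1 by
          have : (n : ℝ) - 1 ≠ 0 := by linarith
          have : (n : ℝ) ≠ 0 := by linarith
          rw [add_zero, sub_zero, add_zero]
          field_simp, spow_one]
      simp only [zero_add, this]
      exact contDiff_coord 1
    | succ i =>
      refine (contDiff_spow ?_).comp
        (((contDiff_spow (one_lt_beta (by omega) (by omega))).comp (contDiff_coord _)).sub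
          (ih (by omega)))
      rw [kap_mul_beta hn hi, one_lt_div (by linarith)]
      linarith

theorem continuous_omega {i : ℕ} (hi : i < n) :
    Continuous fun x : Fin n → ℝ => omega n l x (i + 1) :=
  ((continuous_spow (beta_pos hn hi)).comp (contDiff_coord _).continuous).sub
    (contDiff_spow_v hn hl hi).continuous

theorem contDiff_W {i : ℕ} (hi : i < n) : ContDiff ℝ 1 fun x : Fin n → ℝ => W n l x (i + 1) := by
  have hb := beta_pos hn hi
  have hform : (fun x : Fin n → ℝ => W n l x (i + 1)) = fun x =>
      |coord x (i + 1)| ^ (beta n i + 1) / (beta n i + 1) + beta n i / (beta n i + 1) *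
        |spow (beta n i) (v n l x i)| ^ ((beta n i + 1) / beta n i) -
          spow (beta n i) (v n l x i) * coord x (i + 1) :=
    funext fun x => tangent_gap_eq hb _ _
  rw [hform]
  have h1 : 1 < (beta n i + 1) / beta n i := by rw [one_lt_div hb]; linarith
  exact ((((contDiff_abs_rpow (by linarith)).comp (contDiff_coord _)).div_const _).add
    (contDiff_const.mul ((contDiff_abs_rpow h1).comp (contDiff_spow_v hn hl hi)))).sub
    ((contDiff_spow_v hn hl hi).mul (contDiff_coord _))

theorem contDiff_partialV {k : ℕ} (hk : k ≤ n) : ContDiff ℝ 1 (partialV n l k) :=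
  ContDiff.sum fun i hi => contDiff_W hn hl (by have := Finset.mem_range.1 hi; omega)

theorem contDiff_V : ContDiff ℝ 1 (V n l) := by
  rw [V_eq_partialV]
  exact contDiff_partialV hn hl le_rfl

end smooth

end lyapunov

/-! ### Homogeneity under dilations -/

section homogeneity

variable {n : ℕ} {l : ℕ → ℝ}

/-- The dilation `x_i ↦ r ^ {p_i} x_i`. -/
noncomputable def dil (n : ℕ) (r : ℝ) : (Fin n → ℝ) →L[ℝ] (Fin n → ℝ) :=
  ContinuousLinearMap.pi fun i => r ^ wt n ((i : ℕ) + 1) • ContinuousLinearMap.proj i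

theorem coord_dil (r : ℝ) (x : Fin n → ℝ) (i : ℕ) :
    coord (dil n r x) i = r ^ wt n i * coord x i := by
  unfold coord
  split_ifs with h
  · simp only [dil, ContinuousLinearMap.coe_pi', smul_apply,
      ContinuousLinearMap.proj_apply, smul_eq_mul]
    rw [Nat.sub_add_cancel h.1]
  · simp

variable (hn : 2 ≤ n)
include hn

theorem v_dil {r : ℝ} (hr : 0 < r) (x : Fin n → ℝ) {i : ℕ} (hi : i < n) :
    v n l (dil n r x) i = r ^ wt n (i + 1) * v n l x i := by
  induction i with
  | zero => simp [v]
  | succ i ih =>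
    have h := ih (by omega)
    rw [v_succ, v_succ, omega_succ, omega_succ, coord_dil, h, spow_rpow_mul hr, spow_rpow_mul hr,
      ← mul_sub, spow_rpow_mul hr, wt_mul_beta_mul_kap hn (by omega)]
    ring

theorem omega_dil {r : ℝ} (hr : 0 < r) (x : Fin n → ℝ) {i : ℕ} (hi : i < n) :
    omega n l (dil n r x) (i + 1) = r ^ (wt n (i + 1) * beta n i) * omega n l x (i + 1) := by
  rw [omega_succ, omega_succ, coord_dil, v_dil hn hr x hi, spow_rpow_mul hr, spow_rpow_mul hr,
    mul_sub]

theorem W_dil {r : ℝ} (hr : 0 < r) (x : Fin n → ℝ) {i : ℕ} (hi : i < n) :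
    W n l (dil n r x) (i + 1) = r ^ deg n * W n l x (i + 1) := by
  have key : ∀ y : ℝ, |r ^ wt n (i + 1) * y| ^ (beta n i + 1) = r ^ deg n * |y| ^ (beta n i + 1) := by
    intro y
    rw [abs_mul, abs_of_pos (Real.rpow_pos_of_pos hr _),
      Real.mul_rpow (Real.rpow_nonneg hr.le _) (abs_nonneg _), ← Real.rpow_mul hr.le,
      wt_mul_beta_add_one hn hi]
  rw [W_succ, W_succ, coord_dil, v_dil hn hr x hi, key, key, spow_rpow_mul hr,
    ← wt_mul_beta_add_one hn hi, mul_add, mul_one, Real.rpow_add hr]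
  ring

theorem partialV_dil {r : ℝ} (hr : 0 < r) (x : Fin n → ℝ) {k : ℕ} (hk : k ≤ n) :
    partialV n l k (dil n r x) = r ^ deg n * partialV n l k x := by
  unfold partialV
  rw [Finset.mul_sum]
  exact Finset.sum_congr rfl fun i hi => W_dil hn hr x (by have := Finset.mem_range.1 hi; omega)

theorem V_dil {r : ℝ} (hr : 0 < r) (x : Fin n → ℝ) : V n l (dil n r x) = r ^ deg n * V n l x := by
  rw [V_eq_partialV]
  exact partialV_dil hn hr x le_rfl

theorem jordan_dil {r : ℝ} (hr : 0 < r) (x : Fin n → ℝ) :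
    (jordan n).mulVec (dil n r x) = r ^ (-(1 / n : ℝ)) • dil n r ((jordan n).mulVec x) := by
  have h2 := two_le_cast hn
  refine ext_coord fun i hi => ?_
  rw [coord_jordan _ hi, coord_dil, coord_smul, coord_dil, coord_jordan _ hi, ← mul_assoc,
    ← Real.rpow_add hr, wt_succ hn (i + 1), wt_succ hn i]
  push_cast
  congr 2
  field_simp
  ring

/-- Differentiating the homogeneity of the partial sum by the chain rule gives its degree; the chain
contributes a further -1/n. -/
theorem fderiv_partialV_dil (hl : ∀ i, 1 ≤ i → i ≤ n → 0 < l i) {r : ℝ} (hr : 0 < r)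
    (x : Fin n → ℝ) {k : ℕ} (hk : k ≤ n) :
    fderiv ℝ (partialV n l k) (dil n r x) ((jordan n).mulVec (dil n r x)) =
      r ^ (deg n - 1 / n) * fderiv ℝ (partialV n l k) x ((jordan n).mulVec x) := by
  have hd : Differentiable ℝ (partialV n l k) :=
    (contDiff_partialV hn hl hk).differentiable one_ne_zero
  have h1 : HasFDerivAt (fun y => partialV n l k (dil n r y))
      ((fderiv ℝ (partialV n l k) (dil n r x)).comp (dil n r)) x :=
    (hd _).hasFDerivAt.comp x (dil n r).hasFDerivAt
  have h2 : HasFDerivAt (fun y => partialV n l k (dil n r y))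
      (r ^ deg n • fderiv ℝ (partialV n l k) x) x := by
    rw [show (fun y => partialV n l k (dil n r y)) = fun y => r ^ deg n * partialV n l k y from
      funext fun y => partialV_dil hn hr y hk]
    exact (hd x).hasFDerivAt.const_mul _
  have h3 := congrArg (fun L => L ((jordan n).mulVec x)) (h1.unique h2)
  simp only [ContinuousLinearMap.comp_apply, smul_apply, smul_eq_mul] at h3
  rw [jordan_dil hn hr, map_smul, smul_eq_mul, h3, ← mul_assoc, ← Real.rpow_add hr]
  congr 2
  ring

theorem abs_omega_rpow_dil {r : ℝ} (hr : 0 < r) (x : Fin n → ℝ) {i : ℕ} (hi : i < n) :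
    |omega n l (dil n r x) (i + 1)| ^ (kap n i + 1) =
      r ^ (deg n - 1 / n) * |omega n l x (i + 1)| ^ (kap n i + 1) := by
  rw [omega_dil hn hr x hi, abs_mul, abs_of_pos (Real.rpow_pos_of_pos hr _),
      Real.mul_rpow (Real.rpow_nonneg hr.le _) (abs_nonneg _), ← Real.rpow_mul hr.le,
      wt_mul_beta_mul_kap_add_one hn hi]

/-- Every nonzero vector can be dilated onto the unit sphere. -/
theorem exists_dil_norm_eq_one {x : Fin n → ℝ} (hx : x ≠ 0) : ∃ r, 0 < r ∧ ‖dil n r x‖ = 1 := by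
  obtain ⟨i, hi, hxi⟩ : ∃ i, ∃ hi : i < n, x ⟨i, hi⟩ ≠ 0 := by
    by_contra! h
    exact hx (funext fun ⟨i, hi⟩ => h i hi)
  have happ : ∀ (r : ℝ) (j : Fin n), dil n r x j = r ^ wt n ((j : ℕ) + 1) * x j := fun r j => rfl
  have hw : ∀ j : Fin n, 0 < wt n ((j : ℕ) + 1) := fun j => wt_pos hn j.isLt
  have hc : Continuous fun r : ℝ => ‖dil n r x‖ := by
    refine continuous_norm.comp (continuous_pi fun j => ?_)
    simp only [happ]
    exact (continuous_id.rpow_const fun _ => Or.inr (hw j).le).mul continuous_const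
  have h0 : ‖dil n 0 x‖ = 0 := by
    rw [norm_eq_zero]
    funext j
    rw [happ, Real.zero_rpow (hw j).ne', zero_mul]
    rfl
  -- At `R` coordinate `i` has absolute value 1, and at 0 the dilated vector vanishes; the
  -- intermediate value theorem supplies norm 1 in between.
  set R : ℝ := |x ⟨i, hi⟩| ^ (-(wt n (i + 1))⁻¹) with hR
  have hR0 : 0 ≤ R := Real.rpow_nonneg (abs_nonneg _) _
  have hR1 : 1 ≤ ‖dil n R x‖ := by
    refine le_trans (le_of_eq ?_) (norm_le_pi_norm (dil n R x) ⟨i, hi⟩)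
    rw [happ, Real.norm_eq_abs, abs_mul, abs_of_nonneg (Real.rpow_nonneg hR0 _), hR,
      ← Real.rpow_mul (abs_nonneg _), neg_mul, inv_mul_cancel₀ (hw ⟨i, hi⟩).ne',
      Real.rpow_neg_one, inv_mul_cancel₀ (abs_ne_zero.2 hxi)]
  obtain ⟨r, hr, hr1⟩ := intermediate_value_Icc hR0 hc.continuousOn
    (show (1 : ℝ) ∈ Icc ‖dil n 0 x‖ ‖dil n R x‖ from ⟨by rw [h0]; exact zero_le_one, hR1⟩)
  refine ⟨r, hr.1.lt_of_ne' ?_, hr1⟩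
  rintro rfl
  simp only [h0] at hr1
  exact zero_ne_one hr1

/-- The Lyapunov function controls the coordinates. -/
theorem exists_coord_bound (hl : ∀ i, 1 ≤ i → i ≤ n → 0 < l i) :
    ∃ m, 0 < m ∧ ∀ (x : Fin n → ℝ) (i : Fin n),
      |x i| ≤ (V n l x / m) ^ (wt n ((i : ℕ) + 1) / deg n) := by
  have hne : (Metric.sphere (0 : Fin n → ℝ) 1).Nonempty := by
    have : Nonempty (Fin n) := ⟨⟨0, by omega⟩⟩
    exact NormedSpace.sphere_nonempty.2 zero_le_one
  -- The constant is the minimum of V_n on the unit sphere, positive by definiteness; dilations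
  -- carry the bound to all vectors.
  obtain ⟨z, hz, hmin⟩ := (isCompact_sphere (0 : Fin n → ℝ) 1).exists_isMinOn hne
    (contDiff_V hn hl).continuous.continuousOn
  have hzpos : 0 < V n l z := V_pos hn (by rintro rfl; simp at hz)
  refine ⟨V n l z, hzpos, fun x i => ?_⟩
  have hw : 0 < wt n ((i : ℕ) + 1) := wt_pos hn i.isLt
  have hdeg := deg_pos hn
  rcases eq_or_ne x 0 with rfl | hx
  · simp only [Pi.zero_apply, abs_zero]
    exact Real.rpow_nonneg (div_nonneg (V_nonneg hn l 0) hzpos.le) _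
  obtain ⟨r, hr, hr1⟩ := exists_dil_norm_eq_one hn hx
  have h1 : V n l z ≤ V n l (dil n r x) := hmin (by simpa using hr1)
  have h2 : r ^ wt n ((i : ℕ) + 1) * |x i| ≤ 1 := by
    have := norm_le_pi_norm (dil n r x) i
    rw [hr1, Real.norm_eq_abs] at this
    rwa [show dil n r x i = r ^ wt n ((i : ℕ) + 1) * x i from rfl, abs_mul,
      abs_of_pos (Real.rpow_pos_of_pos hr _)] at this
  rw [V_dil hn hr] at h1
  have h3 : r⁻¹ ^ deg n ≤ V n l x / V n l z := by
    rw [Real.inv_rpow hr.le, le_div_iff₀ hzpos, inv_mul_le_iff₀ (Real.rpow_pos_of_pos hr _)]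
    exact h1
  calc |x i| ≤ r⁻¹ ^ wt n ((i : ℕ) + 1) := by
        rw [Real.inv_rpow hr.le, ← one_div, le_div_iff₀ (Real.rpow_pos_of_pos hr _)]
        linarith
    _ = (r⁻¹ ^ deg n) ^ (wt n ((i : ℕ) + 1) / deg n) := by
        rw [← Real.rpow_mul (inv_nonneg.2 hr.le), mul_div_cancel₀ _ hdeg.ne']
    _ ≤ _ := Real.rpow_le_rpow (Real.rpow_nonneg (inv_nonneg.2 hr.le) _) h3
        (div_pos hw hdeg).le

end homogeneity

/-! ### Choice of the gains by backstepping -/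

section backstepping

variable {n : ℕ} {l : ℕ → ℝ} (hn : 2 ≤ n)
include hn

/-- Among the first k + 1 summands only the last involves x_{k+1}, and v_k does not. -/
theorem fderiv_partialV_basisVec (hl : ∀ i, 1 ≤ i → i ≤ n → 0 < l i) (x : Fin n → ℝ) {k : ℕ}
    (hk : k < n) :
    fderiv ℝ (partialV n l (k + 1)) x (basisVec n (k + 1)) = omega n l x (k + 1) := by
  have hb := beta_pos hn hk
  have h1 : HasDerivAt (fun t : ℝ => partialV n l (k + 1) (x + t • basisVec n (k + 1)))
      (fderiv ℝ (partialV n l (k + 1)) x (basisVec n (k + 1))) 0 :=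
    (((contDiff_partialV hn hl hk).differentiable one_ne_zero) x).hasFDerivAt.hasLineDerivAt _
  have hcoord : ∀ t : ℝ, ∀ i ≤ k, coord (x + t • basisVec n (k + 1)) i = coord x i := by
    intro t i hi
    rw [coord_add, coord_smul, coord_basisVec_of_ne (by omega), mul_zero, add_zero]
  have hform : (fun t : ℝ => partialV n l (k + 1) (x + t • basisVec n (k + 1))) = fun t =>
      partialV n l k x + ((|coord x (k + 1) + t| ^ (beta n k + 1) -
        |v n l x k| ^ (beta n k + 1)) / (beta n k + 1) -
          spow (beta n k) (v n l x k) * (coord x (k + 1) + t - v n l x k)) := by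
    funext t
    rw [partialV_succ, partialV_congr (fun _ _ => rfl) (hcoord t), W_succ,
      v_congr (fun _ _ => rfl) (hcoord t), coord_add, coord_smul, coord_basisVec _ hk, if_pos rfl,
      mul_one]
  rw [hform] at h1
  have h2 : HasDerivAt (fun t : ℝ => coord x (k + 1) + t) 1 0 := (hasDerivAt_id 0).const_add _
  have h3 : HasDerivAt (fun t : ℝ => |coord x (k + 1) + t| ^ (beta n k + 1))
      ((beta n k + 1) * spow (beta n k) (coord x (k + 1) + 0) * 1) 0 :=
    (hasDerivAt_abs_rpow_add_one hb (coord x (k + 1) + 0)).comp 0 h2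
  have h4 := ((((h3.sub_const (|v n l x k| ^ (beta n k + 1))).div_const (beta n k + 1)).sub
    ((h2.sub_const (v n l x k)).const_mul (spow (beta n k) (v n l x k)))).const_add
      (partialV n l k x))
  rw [h1.unique h4, omega_succ]
  field_simp
  simp

/-- Such a point is a global minimum of W_{k+1}, so no derivative of v_k has to be computed. -/
theorem fderiv_W_eq_zero {x : Fin n → ℝ} {k : ℕ} (hk : k < n) (h : omega n l x (k + 1) = 0) :
    fderiv ℝ (fun x => W n l x (k + 1)) x = 0 := by
  refine IsLocalMin.fderiv_eq_zero (Eventually.of_forall fun y => ?_)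
  have : W n l x (k + 1) = 0 :=
    (W_eq_zero_iff hn l x hk).2 ((omega_eq_zero_iff hn l x hk).1 h)
  simp only [this]
  exact W_nonneg hn l y hk

/-- On the zero set of `ω_{k+1}` the derivative along the chain reduces to the previous stage. -/
theorem fderiv_partialV_neg_of_omega_eq_zero (hl : ∀ i, 1 ≤ i → i ≤ n → 0 < l i) {k : ℕ}
    (hk : k < n)
    (hprev : ∀ x : Fin n → ℝ, x ≠ 0 → (∀ i, k < i → coord x i = 0) →
      fderiv ℝ (partialV n l k) x ((jordan n).mulVec x) + omega n l x k * v n l x k < 0)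
    {x : Fin n → ℝ} (hx : x ≠ 0) (hsupp : ∀ i, k + 1 < i → coord x i = 0)
    (h : omega n l x (k + 1) = 0) :
    fderiv ℝ (partialV n l (k + 1)) x ((jordan n).mulVec x) < 0 := by
  set c := coord x (k + 1) with hc
  have hcv : c = v n l x k := (omega_eq_zero_iff hn l x hk).1 h
  -- Deleting coordinate k + 1 puts the vector in the subspace where `hprev` applies; the deleted
  -- value `c` = v_k returns below as the control input of the shorter chain.
  set y : Fin n → ℝ := x + (-c) • basisVec n (k + 1) with hy
  have hxy : x = y + c • basisVec n (k + 1) := by rw [hy, add_assoc, ← add_smul]; simp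
  have hycoord : ∀ i ≤ k, coord y i = coord x i := by
    intro i hi
    rw [hy, coord_add, coord_smul, coord_basisVec_of_ne (by omega), mul_zero, add_zero]
  have hysupp : ∀ i, k < i → coord y i = 0 := by
    intro i hi
    rw [hy, coord_add, coord_smul]
    rcases (show k + 1 ≤ i from hi).eq_or_lt with rfl | hi'
    · rw [coord_basisVec _ hk, if_pos rfl, ← hc]; ring
    · rw [hsupp i hi', coord_basisVec_of_ne (by omega)]; ring
  have hvy : v n l x k = v n l y k := v_congr (fun _ _ => rfl) fun i hi => (hycoord i hi).symm
  have hy0 : y ≠ 0 := by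
    intro hy0
    have hc0 : c = 0 := by
      rw [hcv, hvy, hy0]
      exact v_eq_zero fun i _ => coord_zero_vec i
    exact hx (by rw [hxy, hy0, hc0]; simp)
  obtain ⟨j, rfl⟩ : ∃ j, k = j + 1 := by
    refine Nat.exists_eq_succ_of_ne_zero ?_
    rintro rfl
    exact hy0 (ext_coord fun i _ => by rw [hysupp _ (by omega), coord_zero_vec])
  have hd : ∀ k ≤ n, Differentiable ℝ (partialV n l k) := fun k hk =>
    (contDiff_partialV hn hl hk).differentiable one_ne_zero
  have hJ : (jordan n).mulVec x = (jordan n).mulVec y + c • basisVec n (j + 1) := by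
    refine ext_coord fun i hi => ?_
    rw [coord_add, coord_jordan _ hi, coord_jordan _ hi, coord_smul]
    nth_rewrite 1 [hxy]
    rw [coord_add, coord_smul]
    congr 2
    by_cases hij : i = j
    · subst hij
      rw [coord_basisVec _ hk, coord_basisVec _ hi, if_pos rfl, if_pos rfl]
    · rw [coord_basisVec_of_ne (by omega), coord_basisVec_of_ne (by omega)]
  have hfd : fderiv ℝ (partialV n l (j + 1)) x = fderiv ℝ (partialV n l (j + 1)) y := by
    nth_rewrite 1 [hxy]
    rw [← fderiv_comp_add_right]
    congr 1
    funext z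
    refine partialV_congr (fun _ _ => rfl) fun i hi => ?_
    rw [coord_add, coord_smul, coord_basisVec_of_ne (by omega), mul_zero, add_zero]
  have hsum : fderiv ℝ (partialV n l (j + 1 + 1)) x = fderiv ℝ (partialV n l (j + 1)) x := by
    rw [show partialV n l (j + 1 + 1) = fun x => partialV n l (j + 1) x + W n l x (j + 1 + 1) from
      funext fun x => partialV_succ l _ x, fderiv_fun_add (hd _ hk.le x)
        ((contDiff_W hn hl hk).differentiable one_ne_zero x), fderiv_W_eq_zero hn hk h, add_zero]
  have := hprev y hy0 hysupp
  rw [hsum, hfd, hJ, map_add, map_smul, fderiv_partialV_basisVec hn hl y (by omega), hcv, hvy,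
    smul_eq_mul, mul_comm (v n l y (j + 1))]
  exact this

omit hn in
-- On the compact part of `K` where `F ≥ 0`, `G` is positive and `F / G` is bounded; any larger
-- positive multiple of `G` wins there, and elsewhere `F` is already negative.
theorem exists_pos_forall_sub_mul_neg {X : Type*} [TopologicalSpace X] {K : Set X}
    (hK : IsCompact K) {F G : X → ℝ} (hF : Continuous F) (hG : Continuous G)
    (hG0 : ∀ x, 0 ≤ G x) (h : ∀ x ∈ K, G x = 0 → F x < 0) :
    ∃ t, 0 < t ∧ ∀ x ∈ K, F x - t * G x < 0 := by
  have hK' : IsCompact (K ∩ {x | 0 ≤ F x}) := hK.inter_right (isClosed_le continuous_const hF)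
  have hpos : ∀ x ∈ K ∩ {x | 0 ≤ F x}, 0 < G x := fun x hx =>
    (hG0 x).lt_of_ne' fun h0 => (h x hx.1 h0).not_ge hx.2
  obtain ⟨M, hM⟩ : ∃ M, ∀ x ∈ K ∩ {x | 0 ≤ F x}, F x / G x ≤ M := by
    obtain ⟨M, hM⟩ := hK'.bddAbove_image
      (f := fun x => F x / G x) (hF.continuousOn.div hG.continuousOn fun x hx => (hpos x hx).ne')
    exact ⟨M, fun x hx => hM (mem_image_of_mem _ hx)⟩
  refine ⟨max M 0 + 1, by positivity, fun x hx => ?_⟩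
  by_cases hFx : 0 ≤ F x
  · have hg := hpos x ⟨hx, hFx⟩
    have h1 := (div_le_iff₀ hg).1 (hM x ⟨hx, hFx⟩)
    have h2 := mul_le_mul_of_nonneg_right (le_max_left M 0) hg.le
    linarith
  · have : 0 ≤ (max M 0 + 1) * G x := mul_nonneg (by positivity) (hG0 x)
    linarith

theorem continuous_fderiv_partialV_jordan (hl : ∀ i, 1 ≤ i → i ≤ n → 0 < l i) {k : ℕ}
    (hk : k ≤ n) :
    Continuous fun x : Fin n → ℝ => fderiv ℝ (partialV n l k) x ((jordan n).mulVec x) :=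
  ((contDiff_partialV hn hl hk).continuous_fderiv one_ne_zero).clm_apply
    (Continuous.matrix_mulVec continuous_const continuous_id)

/-- One step of the choice of the gains. -/
theorem exists_gain (hl : ∀ i, 1 ≤ i → i ≤ n → 0 < l i) {k : ℕ} (hk : k < n)
    (hprev : ∀ x : Fin n → ℝ, x ≠ 0 → (∀ i, k < i → coord x i = 0) →
      fderiv ℝ (partialV n l k) x ((jordan n).mulVec x) + omega n l x k * v n l x k < 0) :
    ∃ t, 0 < t ∧ ∀ x : Fin n → ℝ, x ≠ 0 → (∀ i, k + 1 < i → coord x i = 0) →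
      fderiv ℝ (partialV n l (k + 1)) x ((jordan n).mulVec x)
        - t * |omega n l x (k + 1)| ^ (kap n k + 1) < 0 := by
  have hkap := kap_nonneg hn hk
  have hclosed : IsClosed {x : Fin n → ℝ | ∀ i, k + 1 < i → coord x i = 0} := by
    simp only [ofPred_forall]
    exact isClosed_iInter fun i => isClosed_iInter fun _ =>
      isClosed_eq (contDiff_coord i).continuous continuous_const
  obtain ⟨t, ht, h⟩ := exists_pos_forall_sub_mul_neg
    ((isCompact_sphere (0 : Fin n → ℝ) 1).inter_right hclosed)
    (continuous_fderiv_partialV_jordan hn hl (k := k + 1) hk)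
    ((continuous_omega hn hl hk).abs.rpow_const fun _ => Or.inr (by linarith : 0 ≤ kap n k + 1))
    (fun x => Real.rpow_nonneg (abs_nonneg _) _) (by
      intro x hx h0
      rw [Real.rpow_eq_zero (abs_nonneg _) (by linarith), abs_eq_zero] at h0
      refine fderiv_partialV_neg_of_omega_eq_zero hn hl hk hprev ?_ hx.2 h0
      rintro rfl
      simp at hx)
  refine ⟨t, ht, fun x hx hsupp => ?_⟩
  -- Both terms scale by the same power of `r`, so the inequality on the sphere passes to every
  -- nonzero vector.
  obtain ⟨r, hr, hr1⟩ := exists_dil_norm_eq_one hn hx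
  have h1 := h (dil n r x) ⟨by simpa using hr1, fun i hi => by
    rw [coord_dil, hsupp i hi, mul_zero]⟩
  rw [fderiv_partialV_dil hn hl hr x hk, abs_omega_rpow_dil hn hr x hk, mul_left_comm,
    ← mul_sub] at h1
  exact neg_of_mul_neg_right h1 (Real.rpow_nonneg hr.le _)

/-- Induction invariant: the truncated chain of length `k`, driven by v_k as its input, strictly
decreases its partial Lyapunov function. The new gain turns ω v into minus the compensating term of
`exists_gain`. -/
theorem exists_gains {k : ℕ} (hk : k < n) : ∃ l : ℕ → ℝ, (∀ i, 1 ≤ i → i ≤ n → 0 < l i) ∧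
    ∀ x : Fin n → ℝ, x ≠ 0 → (∀ i, k < i → coord x i = 0) →
      fderiv ℝ (partialV n l k) x ((jordan n).mulVec x) + omega n l x k * v n l x k < 0 := by
  induction k with
  | zero =>
    refine ⟨fun _ => 1, fun _ _ _ => one_pos, fun x hx h => ?_⟩
    exact absurd (ext_coord fun i _ => by rw [h _ (by omega), coord_zero_vec]) hx
  | succ k ih =>
    obtain ⟨l, hl, hprev⟩ := ih (by omega)
    obtain ⟨t, ht, h⟩ := exists_gain hn hl (by omega) hprev
    have hll : ∀ i ≤ k, Function.update l (k + 1) t i = l i := fun i hi =>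
      Function.update_of_ne (by omega) _ _
    refine ⟨Function.update l (k + 1) t, fun i h1 h2 => ?_, fun x hx hsupp => ?_⟩
    · by_cases hi : i = k + 1
      · subst hi; simpa using ht
      · rw [Function.update_of_ne hi]; exact hl i h1 h2
    · have h1 := h x hx hsupp
      have h2 : partialV n (Function.update l (k + 1) t) (k + 1) = partialV n l (k + 1) :=
        funext fun y => partialV_congr (fun i hi => hll i (by omega)) fun _ _ => rfl
      have h3 : omega n (Function.update l (k + 1) t) x (k + 1) = omega n l x (k + 1) :=
        omega_congr hll fun _ _ => rfl
      rw [h2, v_succ, h3, Function.update_self]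
      have h4 := spow_mul_self (kap_pos hn hk) (omega n l x (k + 1))
      rw [← h4] at h1
      linarith

theorem exists_admissible : ∃ (l : ℕ → ℝ) (c : ℝ), Admissible n l c := by
  obtain ⟨k, rfl⟩ : ∃ k, n = k + 1 := ⟨n - 1, by omega⟩
  obtain ⟨l', hl', hprev⟩ := exists_gains hn (Nat.lt_succ_self k)
  obtain ⟨t, ht, h⟩ := exists_gain hn hl' (Nat.lt_succ_self k) hprev
  set l := Function.update l' (k + 1) t with hldef
  have hll : ∀ i ≤ k, l i = l' i := fun i hi => Function.update_of_ne (by omega) _ _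
  have hlt : l (k + 1) = t := Function.update_self _ _ _
  have hl : ∀ i, 1 ≤ i → i ≤ k + 1 → 0 < l i := by
    intro i h1 h2
    by_cases hi : i = k + 1
    · rw [hi, hlt]; exact ht
    · rw [hll i (by omega)]; exact hl' i h1 h2
  have hpV : partialV (k + 1) l (k + 1) = partialV (k + 1) l' (k + 1) :=
    funext fun y => partialV_congr (fun i hi => hll i (by omega)) fun _ _ => rfl
  have hneg : ∀ x : Fin (k + 1) → ℝ, x ≠ 0 →
      fderiv ℝ (V (k + 1) l) x ((jordan (k + 1)).mulVec x)
        - t * |omega (k + 1) l x (k + 1)| < 0 := by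
    intro x hx
    have := h x hx fun i hi => coord_of_lt x hi
    rw [kap_last hn rfl, zero_add, Real.rpow_one] at this
    rwa [V_eq_partialV, hpV, omega_congr hll fun _ _ => rfl]
  have hVc : Continuous (V (k + 1) l) := (contDiff_V hn hl).continuous
  have halpha := alpha_pos hn
  -- `G` is the absolute decay rate, which has no zero on the sphere, so the condition on its zero
  -- set is vacuous; c_n is the inverse of the constant obtained.
  obtain ⟨c, hc, hcK⟩ := exists_pos_forall_sub_mul_neg
    (isCompact_sphere (0 : Fin (k + 1) → ℝ) 1)
    (F := fun x => V (k + 1) l x ^ alpha (k + 1))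
    (G := fun x => |fderiv ℝ (V (k + 1) l) x ((jordan (k + 1)).mulVec x)
        - t * (|omega (k + 1) l x (k + 1)|)|)
    (hVc.rpow_const fun _ => Or.inr halpha.le)
    (by
      rw [V_eq_partialV]
      exact ((continuous_fderiv_partialV_jordan hn hl le_rfl).sub
        (continuous_const.mul (continuous_omega hn hl (Nat.lt_succ_self k)).abs)).abs)
    (fun _ => abs_nonneg _) (by
      intro x hx h0
      rw [abs_eq_zero] at h0
      exact absurd h0 (hneg x (by rintro rfl; simp at hx)).ne)
  refine ⟨l, c⁻¹, hl, inv_pos.2 hc, fun x hx u s hs => ?_⟩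
  have hmain : fderiv ℝ (V (k + 1) l) x ((jordan (k + 1)).mulVec x)
        - t * |omega (k + 1) l x (k + 1)| ≤ -c⁻¹ * V (k + 1) l x ^ alpha (k + 1) := by
    obtain ⟨r, hr, hr1⟩ := exists_dil_norm_eq_one hn hx
    have h1 := hcK (dil (k + 1) r x) (by simpa using hr1)
    have h2 := hneg (dil (k + 1) r x) (by intro h0; rw [h0] at hr1; simp at hr1)
    have h3 := abs_omega_rpow_dil (l := l) hn hr x (Nat.lt_succ_self k)
    rw [kap_last hn rfl, zero_add, Real.rpow_one, Real.rpow_one] at h3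
    simp only [abs_of_neg h2] at h1
    rw [V_dil hn hr, V_eq_partialV, fderiv_partialV_dil hn hl hr x le_rfl, h3,
      Real.mul_rpow (Real.rpow_nonneg hr.le _) (by rw [← V_eq_partialV]; exact V_nonneg hn l x),
      ← Real.rpow_mul hr.le, deg_mul_alpha hn, ← V_eq_partialV] at h1
    have h4 : (r ^ (deg (k + 1) - 1 / (k + 1 : ℕ))) * (V (k + 1) l x ^ alpha (k + 1) +
        c * (fderiv ℝ (V (k + 1) l) x ((jordan (k + 1)).mulVec x)
          - t * |omega (k + 1) l x (k + 1)|)) < 0 := by linarith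
    have h5 := neg_of_mul_neg_right h4 (Real.rpow_nonneg hr.le _)
    rw [neg_mul, le_neg, inv_mul_le_iff₀ hc]
    linarith
  have hs' : omega (k + 1) l x (k + 1) * s = |omega (k + 1) l x (k + 1)| := by
    rcases hs with ⟨h0, rfl⟩ | ⟨h0, -⟩
    · rw [← mul_div_assoc, ← abs_mul_abs_self, mul_div_assoc,
        div_self (abs_ne_zero.2 h0), mul_one]
    · rw [h0]; simp
  have hu : fderiv ℝ (V (k + 1) l) x (lastVec (k + 1)) = omega (k + 1) l x (k + 1) := by
    rw [lastVec_eq, V_eq_partialV]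
    exact fderiv_partialV_basisVec hn hl x (Nat.lt_succ_self k)
  rw [map_add, map_smul, hu, hlt, mul_add, mul_left_comm, hs', smul_eq_mul]
  linarith

end backstepping

/-! ### Composition with absolutely continuous curves -/

theorem AbsolutelyContinuousOnInterval.lipschitzOnWith_comp {X Y : Type*} [PseudoMetricSpace X]
    [PseudoMetricSpace Y] {f : ℝ → X} {g : X → Y} {a b : ℝ} {K : NNReal}
    (hf : AbsolutelyContinuousOnInterval f a b) (hg : LipschitzOnWith K g (f '' uIcc a b)) :
    AbsolutelyContinuousOnInterval (fun t => g (f t)) a b := by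
  have h0 : Tendsto (fun E : ℕ × (ℕ → ℝ × ℝ) =>
      (K : ℝ) * ∑ i ∈ Finset.range E.1, dist (f (E.2 i).1) (f (E.2 i).2))
      (AbsolutelyContinuousOnInterval.totalLengthFilter ⊓
        𝓟 (AbsolutelyContinuousOnInterval.disjWithin a b)) (𝓝 0) := by
    simpa using Tendsto.const_mul (K : ℝ) hf
  refine squeeze_zero' (Eventually.of_forall fun E => Finset.sum_nonneg fun _ _ => dist_nonneg)
    ?_ h0
  filter_upwards [mem_inf_of_right (mem_principal_self _)] with E hE
  rw [Finset.mul_sum]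
  refine Finset.sum_le_sum fun i hi => ?_
  exact hg.dist_le_mul _ (mem_image_of_mem _ (hE.1 i hi).1) _ (mem_image_of_mem _ (hE.1 i hi).2)

theorem AbsolutelyContinuousOnInterval.contDiff_comp {E : Type*} [NormedAddCommGroup E]
    [NormedSpace ℝ E] {f : ℝ → E} {g : E → ℝ} {a b : ℝ}
    (hf : AbsolutelyContinuousOnInterval f a b) (hg : ContDiff ℝ 1 g) :
    AbsolutelyContinuousOnInterval (fun t => g (f t)) a b := by
  obtain ⟨K, hK⟩ := (hg.locallyLipschitz.locallyLipschitzOn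
    (s := f '' uIcc a b)).exists_lipschitzOnWith_of_compact
      (isCompact_uIcc.image_of_continuousOn hf.continuousOn)
  exact lipschitzOnWith_comp hf hK

/-! ### The Filippov inclusion and its reduction to a scalar inequality -/

section inclusion

variable {n : ℕ} {l : ℕ → ℝ}

theorem abs_le_one_of_mem_signSet {a s : ℝ} (h : s ∈ signSet a) : |s| ≤ 1 := by
  rcases h with ⟨h0, rfl⟩ | ⟨-, h⟩
  · rw [abs_div, abs_abs, div_self (abs_ne_zero.2 h0)]
  · exact abs_le.2 h

theorem mem_signSet_of_pos {a s : ℝ} (ha : 0 < a) : s ∈ signSet a ↔ s = 1 := by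
  constructor
  · rintro (⟨-, rfl⟩ | ⟨h, -⟩)
    · rw [abs_of_pos ha, div_self ha.ne']
    · exact absurd h ha.ne'
  · rintro rfl
    exact Or.inl ⟨ha.ne', by rw [abs_of_pos ha, div_self ha.ne']⟩

theorem mem_signSet_of_neg {a s : ℝ} (ha : a < 0) : s ∈ signSet a ↔ s = -1 := by
  have h1 : a / |a| = -1 := by rw [abs_of_neg ha, div_neg, div_self ha.ne]
  constructor
  · rintro (⟨-, rfl⟩ | ⟨h, -⟩)
    · exact h1
    · exact absurd h ha.ne
  · rintro rfl
    exact Or.inl ⟨ha.ne, h1.symm⟩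

theorem signSet_nonempty (a : ℝ) : (signSet a).Nonempty := by
  rcases eq_or_ne a 0 with rfl | h
  · exact ⟨0, Or.inr ⟨rfl, by norm_num⟩⟩
  · exact ⟨_, Or.inl ⟨h, rfl⟩⟩

/-- A coordinate slab is closed and convex, so it contains the closed convex hull; the empty null
set suffices. -/
theorem apply_mem_Icc_of_mem_filippov {F : (Fin n → ℝ) → Set (Fin n → ℝ)} {x w : Fin n → ℝ}
    (hw : w ∈ filippov F x) (i : Fin n) {δ a b : ℝ} (hδ : 0 < δ)
    (h : ∀ y ∈ Metric.ball x δ, ∀ z ∈ F y, z i ∈ Icc a b) : w i ∈ Icc a b := by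
  simp only [filippov, mem_iInter] at hw
  have h1 := hw δ hδ ∅ measure_empty
  set C : Set (Fin n → ℝ) := (LinearMap.proj i : (Fin n → ℝ) →ₗ[ℝ] ℝ) ⁻¹' Icc a b with hC
  have hconv : Convex ℝ C := (convex_Icc a b).linear_preimage _
  have hclosed : IsClosed C := isClosed_Icc.preimage (continuous_apply i)
  have hsub : closure (convexHull ℝ (⋃ y ∈ Metric.ball x δ \ ∅, F y)) ⊆ C := by
    refine closure_minimal (convexHull_min ?_ hconv) hclosed
    refine iUnion₂_subset fun y hy z hz => ?_
    exact h y hy.1 z hz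
  exact hsub h1

variable (hn : 2 ≤ n) (hl : ∀ i, 1 ≤ i → i ≤ n → 0 < l i)
include hn hl

/-- The right-hand side is upper semicontinuous with closed convex values, so that its Filippov
regularization does not enlarge it. -/
theorem filippov_rhs_subset (d : ℝ) (x : Fin n → ℝ) :
    filippov (rhs n l d) x ⊆ rhs n l d x := by
  intro w hw
  obtain ⟨k, rfl⟩ : ∃ k, n = k + 1 := ⟨n - 1, by omega⟩
  have hlk : 0 < l (k + 1) := hl _ (by omega) le_rfl
  have hval : ∀ y z, z ∈ rhs (k + 1) l d y → ∃ s ∈ signSet (omega (k + 1) l y (k + 1) + d),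
      ∀ i < k + 1, coord z (i + 1) = coord y (i + 2) - l (k + 1) * s * if i = k then 1 else 0 := by
    rintro y z ⟨s, hs, rfl⟩
    refine ⟨s, hs, fun i hi => ?_⟩
    rw [sub_eq_add_neg, ← neg_smul, coord_add, coord_smul, coord_jordan _ hi, lastVec_eq,
      coord_basisVec _ hi]
    simp only [Nat.add_right_cancel_iff]
    ring
  have hchain : ∀ i < k, coord w (i + 1) = coord x (i + 2) := by
    intro i hi
    refine eq_of_abs_sub_le_all fun δ hδ => ?_
    have := apply_mem_Icc_of_mem_filippov hw ⟨i, by omega⟩ (a := coord x (i + 2) - δ)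
      (b := coord x (i + 2) + δ) hδ (by
        intro y hy z hz
        obtain ⟨s, -, h⟩ := hval y z hz
        have h1 := h i (by omega)
        rw [if_neg hi.ne, mul_zero, sub_zero, coord_succ _ (by omega)] at h1
        rw [h1, coord_succ _ (show i + 1 < k + 1 by omega),
          coord_succ _ (show i + 1 < k + 1 by omega)]
        have h2 := (dist_le_pi_dist y x ⟨i + 1, by omega⟩).trans (Metric.mem_ball.1 hy).le
        rw [Real.dist_eq, abs_le] at h2
        exact ⟨by linarith [h2.1], by linarith [h2.2]⟩)
    rw [coord_succ _ (by omega : i < k + 1), abs_le]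
    exact ⟨by linarith [this.1], by linarith [this.2]⟩
  have hlast : ∀ {δ a b : ℝ}, 0 < δ → (∀ y ∈ Metric.ball x δ,
      ∀ s ∈ signSet (omega (k + 1) l y (k + 1) + d), -(l (k + 1) * s) ∈ Icc a b) →
      coord w (k + 1) ∈ Icc a b := by
    intro δ a b hδ h
    rw [coord_succ _ (Nat.lt_succ_self k)]
    refine apply_mem_Icc_of_mem_filippov hw _ hδ fun y hy z hz => ?_
    obtain ⟨s, hs, h'⟩ := hval y z hz
    have h1 := h' k (Nat.lt_succ_self k)
    rw [coord_of_lt y (by omega : k + 1 < k + 2), coord_succ _ (Nat.lt_succ_self k), if_pos rfl,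
      mul_one, zero_sub] at h1
    rw [h1]
    exact h y hy s hs
  have hcont : Continuous fun y : Fin (k + 1) → ℝ => omega (k + 1) l y (k + 1) + d :=
    (continuous_omega hn hl (Nat.lt_succ_self k)).add continuous_const
  -- Off the switching surface the sign is constant on a small ball; on it only |s| ≤ 1 is needed,
  -- since the sign is then the whole interval.
  have key : -(coord w (k + 1)) / l (k + 1) ∈ signSet (omega (k + 1) l x (k + 1) + d) := by
    rcases lt_trichotomy (omega (k + 1) l x (k + 1) + d) 0 with h | h | h
    · obtain ⟨δ, hδ, hball⟩ := Metric.isOpen_iff.1 (isOpen_lt hcont continuous_const) x h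
      have := hlast (a := l (k + 1)) (b := l (k + 1)) hδ fun y hy s hs => by
        rw [(mem_signSet_of_neg (hball hy)).1 hs]; simp
      rw [mem_signSet_of_neg h, le_antisymm this.2 this.1, neg_div, div_self hlk.ne']
    · have := hlast (a := -l (k + 1)) (b := l (k + 1)) one_pos fun y hy s hs => by
        have hs1 := abs_le.1 (abs_le_one_of_mem_signSet hs)
        constructor <;> nlinarith
      refine Or.inr ⟨h, ?_, ?_⟩
      · rw [le_div_iff₀ hlk]; linarith [this.2]
      · rw [div_le_iff₀ hlk]; linarith [this.1]
    · obtain ⟨δ, hδ, hball⟩ := Metric.isOpen_iff.1 (isOpen_lt continuous_const hcont) x h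
      have := hlast (a := -l (k + 1)) (b := -l (k + 1)) hδ fun y hy s hs => by
        rw [(mem_signSet_of_pos (hball hy)).1 hs]; simp
      rw [mem_signSet_of_pos h, le_antisymm this.2 this.1, neg_neg, div_self hlk.ne']
  refine ⟨_, key, ext_coord fun i hi => ?_⟩
  rw [sub_eq_add_neg, ← neg_smul, coord_add, coord_smul, coord_jordan _ hi, lastVec_eq,
    coord_basisVec _ hi, mul_div_cancel₀ _ hlk.ne']
  rcases (Nat.lt_succ_iff.1 hi).eq_or_lt with rfl | hik
  · rw [coord_of_lt x (by omega : i + 1 < i + 2), if_pos rfl]; ring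
  · rw [hchain i hik, if_neg (by omega)]; ring

omit hl in
/-- The dissipation inequality for the disturbed inclusion. -/
theorem Admissible.fderiv_le {c : ℝ} (hA : Admissible n l c) {d : ℝ} {x w : Fin n → ℝ}
    (hw : w ∈ rhs n l d x) :
    fderiv ℝ (V n l) x w ≤ -c * V n l x ^ alpha n + 2 * l n * |d| := by
  have hln : 0 < l n := hA.1 n (by omega) le_rfl
  have hd := abs_nonneg d
  rcases eq_or_ne x 0 with rfl | hx
  -- Admissibility says nothing at the origin, but V_n is minimal there.
  · have : fderiv ℝ (V n l) 0 = 0 := IsLocalMin.fderiv_eq_zero (Eventually.of_forall fun y => by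
      rw [V_zero hn]; exact V_nonneg hn l y)
    rw [this, V_zero hn, Real.zero_rpow (alpha_pos hn).ne', mul_zero, zero_add]
    exact mul_nonneg (by linarith) hd
  obtain ⟨s, hs, rfl⟩ := hw
  rw [sub_eq_add_neg, ← neg_smul]
  have hs1 := abs_le_one_of_mem_signSet hs
  -- If |d| < |ω_n|, the disturbance cannot flip the sign; otherwise |ω_n| ≤ |d|, and two signs
  -- differ by at most 2.
  by_cases hcase : |d| < |omega n l x n|
  · have hs' : s ∈ signSet (omega n l x n) := by
      rcases lt_trichotomy (omega n l x n) 0 with h | h | h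
      · rw [abs_of_neg h] at hcase
        have h1 : omega n l x n + d < 0 := by linarith [le_abs_self d]
        rw [mem_signSet_of_neg h]
        exact (mem_signSet_of_neg h1).1 hs
      · rw [h, abs_zero] at hcase
        exact absurd hd hcase.not_ge
      · rw [abs_of_pos h] at hcase
        have h1 : 0 < omega n l x n + d := by linarith [neg_abs_le d]
        rw [mem_signSet_of_pos h]
        exact (mem_signSet_of_pos h1).1 hs
    have h1 := hA.2.2 x hx (-(l n * s)) s hs'
    rw [neg_add_cancel, mul_zero, add_zero] at h1
    exact h1.trans (le_add_of_nonneg_right (mul_nonneg (by linarith) hd))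
  · obtain ⟨s', hs'⟩ := signSet_nonempty (omega n l x n)
    refine (hA.2.2 x hx (-(l n * s)) s' hs').trans ?_
    refine add_le_add le_rfl ?_
    calc omega n l x n * (-(l n * s) + l n * s')
        ≤ |omega n l x n * (-(l n * s) + l n * s')| := le_abs_self _
      _ = |omega n l x n| * (l n * |s' - s|) := by
          rw [abs_mul, show -(l n * s) + l n * s' = l n * (s' - s) by ring, abs_mul,
            abs_of_pos hln]
      _ ≤ |d| * (l n * 2) := by
          have := abs_sub s' s
          have := abs_le_one_of_mem_signSet hs'
          exact mul_le_mul (not_lt.1 hcase) (mul_le_mul_of_nonneg_left (by linarith) hln.le)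
            (mul_nonneg hln.le (abs_nonneg _)) hd
      _ = 2 * l n * |d| := by ring

end inclusion

/-- A scalar function whose derivative is at most `- c φ ^ α + L |d|` almost everywhere on `[0, ∞)`. -/
structure IsDissipative (φ d : ℝ → ℝ) (α c L : ℝ) : Prop where
  nonneg : ∀ t, 0 ≤ φ t
  ac : ∀ T, 0 ≤ T → AbsolutelyContinuousOnInterval φ 0 T
  deriv_le : ∀ᵐ t ∂mu, ∃ φ', HasDerivAt φ φ' t ∧ φ' ≤ -c * φ t ^ α + L * |d t|

theorem Admissible.isDissipative {n : ℕ} {l : ℕ → ℝ} (hn : 2 ≤ n) {c : ℝ}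
    (hA : Admissible n l c) {d : ℝ → ℝ} {x : ℝ → Fin n → ℝ}
    (hx : IsFilippovSolution (fun t => rhs n l (d t)) x) :
    IsDissipative (fun t => V n l (x t)) d (alpha n) c (2 * l n) where
  nonneg t := V_nonneg hn l (x t)
  ac T hT := AbsolutelyContinuousOnInterval.contDiff_comp (hx.1 T hT) (contDiff_V hn hA.1)
  deriv_le := by
    filter_upwards [hx.2] with t ⟨w, hw, hxt⟩
    exact ⟨_, ((contDiff_V hn hA.1).differentiable one_ne_zero _).hasFDerivAt.comp_hasDerivAt t hxt,
      hA.fderiv_le hn (filippov_rhs_subset hn hA.1 _ _ hw)⟩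

/-! ### Scalar energy estimates -/

theorem sub_le_intervalIntegral {U F : ℝ → ℝ}
    (hU : ∀ T, 0 ≤ T → AbsolutelyContinuousOnInterval U 0 T)
    (h : ∀ᵐ t ∂mu, ∃ u', HasDerivAt U u' t ∧ u' ≤ F t) {a b : ℝ} (ha : 0 ≤ a) (hab : a ≤ b)
    (hF : IntervalIntegrable F volume a b) : U b - U a ≤ ∫ t in a..b, F t := by
  have hac : AbsolutelyContinuousOnInterval U a b := (hU b (ha.trans hab)).mono (by
    rw [uIcc_of_le hab, uIcc_of_le (ha.trans hab)]
    exact Icc_subset_Icc_left ha)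
  rw [← hac.integral_deriv_eq_sub]
  refine intervalIntegral.integral_mono_ae_restrict hab hac.intervalIntegrable_deriv hF ?_
  have hsub : Icc a b ⊆ Ici 0 := fun t ht => ha.trans ht.1
  filter_upwards [ae_restrict_of_ae_restrict_of_subset hsub h] with t ⟨u', h1, h2⟩
  rwa [h1.deriv]

/-- Young's inequality as a weighted mean, a form that includes q = 1, where the conjugate exponent
is infinite. -/
theorem mul_rpow_sub_one_le {a y q : ℝ} (ha : 0 ≤ a) (hy : 0 ≤ y) (hq : 1 ≤ q) :
    a * y ^ (q - 1) ≤ a ^ q / q + (q - 1) / q * y ^ q := by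
  have hq0 : q ≠ 0 := by linarith
  have h := Real.geom_mean_le_arith_mean2_weighted (w₁ := 1 / q) (w₂ := (q - 1) / q)
    (p₁ := a ^ q) (p₂ := y ^ q) (by positivity) (div_nonneg (by linarith) (by linarith))
    (Real.rpow_nonneg ha _) (Real.rpow_nonneg hy _) (by field_simp; ring)
  rw [← Real.rpow_mul ha, ← Real.rpow_mul hy, mul_div_cancel₀ _ hq0, mul_div_cancel₀ _ hq0,
    Real.rpow_one] at h
  linarith [show 1 / q * a ^ q = a ^ q / q by ring]

theorem dissipation_mul_le {c L γ y a q u : ℝ} (hc : 0 < c) (hL : 0 < L) (hγ : 0 ≤ γ)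
    (hy : 0 ≤ y) (ha : 0 ≤ a) (hq : 1 ≤ q) (hu : u ≤ -c * y + L * a) :
    u * γ * y ^ (q - 1) ≤ γ * c / q * (L / c) ^ q * a ^ q - γ * c / q * y ^ q := by
  have hq0 : q ≠ 0 := by linarith
  have hyq : y ^ q = y ^ (q - 1) * y := by
    rw [← Real.rpow_add_one' hy (by linarith), sub_add_cancel]
  have hyoung := mul_rpow_sub_one_le (a := L / c * a) (mul_nonneg (div_pos hL hc).le ha) hy hq
  rw [Real.mul_rpow (div_pos hL hc).le ha] at hyoung
  have hyp : 0 ≤ y ^ (q - 1) := Real.rpow_nonneg hy _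
  calc u * γ * y ^ (q - 1)
      ≤ (-c * y + L * a) * γ * y ^ (q - 1) :=
        mul_le_mul_of_nonneg_right (mul_le_mul_of_nonneg_right hu hγ) hyp
    _ = γ * c * (L / c * a * y ^ (q - 1) - y ^ q) := by
        rw [hyq]
        field_simp
        ring
    _ ≤ γ * c * ((L / c) ^ q * a ^ q / q + (q - 1) / q * y ^ q - y ^ q) :=
        mul_le_mul_of_nonneg_left (sub_le_sub_right hyoung _) (mul_nonneg hγ hc.le)
    _ = γ * c / q * (L / c) ^ q * a ^ q - γ * c / q * y ^ q := by
        generalize (L / c) ^ q = A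
        generalize a ^ q = B
        generalize y ^ q = C
        field_simp
        ring

namespace IsDissipative

variable {φ d : ℝ → ℝ} {α c L : ℝ} (hφ : IsDissipative φ d α c L)
include hφ

theorem continuousOn : ContinuousOn φ (Ici 0) := by
  intro t ht
  have ht' : (0 : ℝ) ≤ t := ht
  have h := (hφ.ac (t + 1) (by linarith)).continuousOn
  rw [uIcc_of_le (by linarith)] at h
  refine (h t ⟨ht', by linarith⟩).mono_of_mem_nhdsWithin ?_
  exact mem_nhdsWithin.2 ⟨Iio (t + 1), isOpen_Iio, by simp, fun s hs => ⟨hs.2, hs.1.le⟩⟩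

theorem continuousOn_rpow {r : ℝ} (hr : 0 ≤ r) : ContinuousOn (fun t => φ t ^ r) (Ici 0) :=
  hφ.continuousOn.rpow_const fun _ _ => Or.inr hr

theorem intervalIntegrable_rpow_rpow {r s : ℝ} (hr : 0 ≤ r) (hs : 0 ≤ s) {a b : ℝ} (ha : 0 ≤ a)
    (hab : a ≤ b) : IntervalIntegrable (fun t => (φ t ^ r) ^ s) volume a b := by
  refine (((hφ.continuousOn_rpow hr).rpow_const fun _ _ => Or.inr hs).mono ?_).intervalIntegrable
  rw [uIcc_of_le hab]
  exact fun t ht => ha.trans ht.1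

variable (hα : 0 < α) (hc : 0 < c) (hL : 0 < L)
include hα hc hL

/-- The exponent is chosen so that differentiating φ^{1+α(q-1)} produces the factor (φ^α)^{q-1},
turning the dissipation φ^α into (φ^α)^q. Dropping one or the other term on the left later gives the
two norm bounds. -/
theorem energy_le {q : ℝ} (hq : 1 ≤ q) (hd : IntegrableOn (fun t => |d t| ^ q) (Ici 0))
    {a b : ℝ} (ha : 0 ≤ a) (hab : a ≤ b) :
    φ b ^ (1 + α * (q - 1)) + (1 + α * (q - 1)) * c / q * ∫ t in a..b, (φ t ^ α) ^ q ≤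
      φ a ^ (1 + α * (q - 1)) +
        (1 + α * (q - 1)) * c / q * (L / c) ^ q * ∫ t in a..b, |d t| ^ q := by
  set β := α * (q - 1) with hβ
  have hβ0 : 0 ≤ β := mul_nonneg hα.le (by linarith)
  have hq0 : q ≠ 0 := by linarith
  set K := (1 + β) * c / q with hK
  have hig := hφ.intervalIntegrable_rpow_rpow hα.le (by linarith : (0 : ℝ) ≤ q) ha hab
  have hid : IntervalIntegrable (fun t => |d t| ^ q) volume a b := by
    refine (hd.mono_set ?_).intervalIntegrable
    rw [uIcc_of_le hab]
    exact fun t ht => ha.trans ht.1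
  have hpow : ContDiff ℝ 1 fun y : ℝ => y ^ (1 + β) := by
    have h1 : ((1 : ℕ) : ℝ) ≤ 1 + β := by push_cast; linarith
    exact_mod_cast Real.contDiff_rpow_const_of_le h1
  have hac : ∀ T, 0 ≤ T → AbsolutelyContinuousOnInterval (fun t => φ t ^ (1 + β)) 0 T :=
    fun T hT => AbsolutelyContinuousOnInterval.contDiff_comp (f := φ)
      (g := fun y : ℝ => y ^ (1 + β)) (hφ.ac T hT) hpow
  have hder : ∀ᵐ t ∂mu, ∃ u', HasDerivAt (fun t => φ t ^ (1 + β)) u' t ∧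
      u' ≤ K * (L / c) ^ q * |d t| ^ q - K * (φ t ^ α) ^ q := by
    filter_upwards [hφ.deriv_le] with t ⟨φ', h1, h2⟩
    refine ⟨_, h1.rpow_const (Or.inr (by linarith)), ?_⟩
    have hφt := hφ.nonneg t
    set y := φ t ^ α with hy
    have hy0 : 0 ≤ y := Real.rpow_nonneg hφt _
    have hyb : φ t ^ (1 + β - 1) = y ^ (q - 1) := by
      rw [hy, ← Real.rpow_mul hφt, add_sub_cancel_left]
    rw [hyb, hK]
    exact dissipation_mul_le hc hL (by linarith) hy0 (abs_nonneg _) hq h2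
  have h := sub_le_intervalIntegral hac hder ha hab ((hid.const_mul _).sub (hig.const_mul _))
  rw [intervalIntegral.integral_sub (hid.const_mul _) (hig.const_mul _),
    intervalIntegral.integral_const_mul, intervalIntegral.integral_const_mul] at h
  linarith

omit hφ hα hc hL in
theorem intervalIntegral_le_integral_mu {h : ℝ → ℝ} (hh : IntegrableOn h (Ici 0))
    (h0 : ∀ t, 0 ≤ h t) {T : ℝ} (hT : 0 ≤ T) : ∫ t in (0 : ℝ)..T, h t ≤ ∫ t, h t ∂mu := by
  rw [intervalIntegral.integral_of_le hT]
  exact setIntegral_mono_set hh (Eventually.of_forall h0)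
    (LE.le.eventuallyLE fun t ht => ht.1.le)

omit hφ hα hc hL in
theorem mu_eq : mu = volume.restrict (Ioi 0) :=
  Measure.restrict_congr_set Ioi_ae_eq_Ici.symm

theorem integrable_and_integral_le {q : ℝ} (hq : 1 ≤ q)
    (hd : IntegrableOn (fun t => |d t| ^ q) (Ici 0)) (h0 : φ 0 = 0) :
    Integrable (fun t => (φ t ^ α) ^ q) mu ∧
      ∫ t, (φ t ^ α) ^ q ∂mu ≤ (L / c) ^ q * ∫ t, |d t| ^ q ∂mu := by
  have hβ0 : 0 ≤ α * (q - 1) := mul_nonneg hα.le (by linarith)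
  have hK : 0 < (1 + α * (q - 1)) * c / q := by positivity
  have hg0 : ∀ t, 0 ≤ (φ t ^ α) ^ q := fun t => Real.rpow_nonneg (Real.rpow_nonneg (hφ.nonneg t) _) _
  have hbound : ∀ T, 0 ≤ T →
      ∫ t in (0 : ℝ)..T, (φ t ^ α) ^ q ≤ (L / c) ^ q * ∫ t, |d t| ^ q ∂mu := by
    intro T hT
    have h := hφ.energy_le hα hc hL hq hd le_rfl hT
    rw [h0, Real.zero_rpow (by linarith), zero_add, mul_assoc] at h
    have hU : 0 ≤ φ T ^ (1 + α * (q - 1)) := Real.rpow_nonneg (hφ.nonneg T) _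
    refine (le_of_mul_le_mul_left ((le_add_of_nonneg_left hU).trans h) hK).trans ?_
    exact mul_le_mul_of_nonneg_left (intervalIntegral_le_integral_mu hd
      (fun t => Real.rpow_nonneg (abs_nonneg _) _) hT) (Real.rpow_nonneg (div_pos hL hc).le _)
  have hint : IntegrableOn (fun t => (φ t ^ α) ^ q) (Ioi 0) := by
    refine integrableOn_Ioi_of_intervalIntegral_norm_bounded
      ((L / c) ^ q * ∫ t, |d t| ^ q ∂mu) 0 (b := fun T => max T 0) (l := atTop)
      (fun T => ?_) (tendsto_atTop_mono (fun T => le_max_left T 0) tendsto_id)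
      (Eventually.of_forall fun T => ?_)
    · rw [← intervalIntegrable_iff_integrableOn_Ioc_of_le (le_max_right T 0)]
      exact hφ.intervalIntegrable_rpow_rpow hα.le (by linarith) le_rfl (le_max_right T 0)
    · simp only [Real.norm_of_nonneg (hg0 _)]
      exact hbound _ (le_max_right T 0)
  rw [mu_eq] at *
  refine ⟨hint, le_of_tendsto (intervalIntegral_tendsto_integral_Ioi 0 hint tendsto_id) ?_⟩
  filter_upwards [eventually_ge_atTop 0] with T hT using hbound T hT

theorem rpow_le {q : ℝ} (hq : 1 ≤ q) (hd : IntegrableOn (fun t => |d t| ^ q) (Ici 0))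
    (h0 : φ 0 = 0) {T : ℝ} (hT : 0 ≤ T) :
    φ T ^ (1 + α * (q - 1)) ≤
      L ^ q * (1 + α * (q - 1)) / c ^ (q - 1) * ∫ t, |d t| ^ q ∂mu := by
  have hβ0 : 0 ≤ α * (q - 1) := mul_nonneg hα.le (by linarith)
  have hK : 0 < (1 + α * (q - 1)) * c / q := by positivity
  have h := hφ.energy_le hα hc hL hq hd le_rfl hT
  rw [h0, Real.zero_rpow (by linarith), zero_add] at h
  have hg : 0 ≤ ∫ t in (0 : ℝ)..T, (φ t ^ α) ^ q :=
    intervalIntegral.integral_nonneg hT fun t _ =>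
      Real.rpow_nonneg (Real.rpow_nonneg (hφ.nonneg t) _) _
  have hD0 : 0 ≤ ∫ t, |d t| ^ q ∂mu := integral_nonneg fun t => Real.rpow_nonneg (abs_nonneg _) _
  have hLc : 0 ≤ (L / c) ^ q := Real.rpow_nonneg (div_pos hL hc).le _
  have hcq : 0 < c ^ (q - 1) := Real.rpow_pos_of_pos hc _
  calc φ T ^ (1 + α * (q - 1))
      ≤ (1 + α * (q - 1)) * c / q * (L / c) ^ q * ∫ t in (0 : ℝ)..T, |d t| ^ q := by
        linarith [mul_nonneg hK.le hg]
    _ ≤ (1 + α * (q - 1)) * c / q * (L / c) ^ q * ∫ t, |d t| ^ q ∂mu :=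
        mul_le_mul_of_nonneg_left (intervalIntegral_le_integral_mu hd
          (fun t => Real.rpow_nonneg (abs_nonneg _) _) hT) (mul_nonneg hK.le hLc)
    -- The gain 1/q ≤ 1 is given away to reach the stated constant.
    _ ≤ (1 + α * (q - 1)) * c / 1 * (L / c) ^ q * ∫ t, |d t| ^ q ∂mu := by gcongr
    _ = L ^ q * (1 + α * (q - 1)) / c ^ (q - 1) * ∫ t, |d t| ^ q ∂mu := by
        congr 1
        rw [Real.div_rpow hL.le hc.le, Real.rpow_sub_one hc.ne']
        field_simp

/-- Subtracting the accumulated disturbance energy from φ^γ leaves a nonincreasing function bounded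
below. Hence φ has a limit, and integrability of (φ^α)^q over the half-line forces it to be 0. -/
theorem tendsto_zero {q : ℝ} (hq : 1 ≤ q) (hd : IntegrableOn (fun t => |d t| ^ q) (Ici 0))
    (h0 : φ 0 = 0) : Tendsto φ atTop (𝓝 0) := by
  have hβ0 : 0 ≤ α * (q - 1) := mul_nonneg hα.le (by linarith)
  set γ := 1 + α * (q - 1) with hγ
  have hγ0 : 0 < γ := by linarith
  set K := γ * c / q * (L / c) ^ q with hKdef
  have hK0 : 0 ≤ K :=
    mul_nonneg (by positivity) (Real.rpow_nonneg (div_pos hL hc).le _)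
  have hdi : ∀ {a b : ℝ}, 0 ≤ a → a ≤ b → IntervalIntegrable (fun t => |d t| ^ q) volume a b := by
    intro a b ha hab
    refine (hd.mono_set ?_).intervalIntegrable
    rw [uIcc_of_le hab]
    exact fun t ht => ha.trans ht.1
  have hg := (hφ.integrable_and_integral_le hα hc hL hq hd h0).1
  set G : ℝ → ℝ := fun t =>
    φ (max t 0) ^ γ - K * ∫ s in (0 : ℝ)..(max t 0), |d s| ^ q with hG
  have hanti : Antitone G := by
    intro s t hst
    have hst' : max s 0 ≤ max t 0 := max_le_max_right 0 hst
    have h := hφ.energy_le hα hc hL hq hd (le_max_right s 0) hst'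
    have hsplit := intervalIntegral.integral_add_adjacent_intervals
      (hdi le_rfl (le_max_right s 0)) (hdi (le_max_right s 0) hst')
    have hgnn : 0 ≤ γ * c / q * ∫ t in max s 0..max t 0, (φ t ^ α) ^ q :=
      mul_nonneg (by positivity) (intervalIntegral.integral_nonneg hst' fun t _ =>
        Real.rpow_nonneg (Real.rpow_nonneg (hφ.nonneg t) _) _)
    simp only [hG, ← hsplit]
    linarith
  have hbdd : BddBelow (range G) := by
    refine ⟨-(K * ∫ t, |d t| ^ q ∂mu), ?_⟩
    rintro _ ⟨t, rfl⟩
    have h1 := mul_le_mul_of_nonneg_left (intervalIntegral_le_integral_mu hd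
      (fun t => Real.rpow_nonneg (abs_nonneg _) _) (le_max_right t 0)) hK0
    have h2 : 0 ≤ φ (max t 0) ^ γ := Real.rpow_nonneg (hφ.nonneg _) _
    simp only [hG]
    linarith
  have hGlim := tendsto_atTop_ciInf hanti hbdd
  have hdlim := (intervalIntegral_tendsto_integral_Ioi 0 (hd.mono_set Ioi_subset_Ici_self)
    (tendsto_atTop_mono (fun T : ℝ => le_max_left T 0) tendsto_id)).const_mul K
  have hUlim : Tendsto (fun t => φ t ^ γ) atTop
      (𝓝 ((⨅ t, G t) + K * ∫ t in Ioi (0 : ℝ), |d t| ^ q)) := by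
    refine (hGlim.add hdlim).congr' ?_
    filter_upwards [eventually_ge_atTop 0] with t ht
    simp only [hG, max_eq_left ht]
    ring
  have hrec : ∀ t, φ t = (φ t ^ γ) ^ γ⁻¹ := fun t => by
    rw [← Real.rpow_mul (hφ.nonneg t), mul_inv_cancel₀ hγ0.ne', Real.rpow_one]
  have hlim : ∃ a, Tendsto φ atTop (𝓝 a) :=
    ⟨_, (hUlim.rpow_const (Or.inr (inv_nonneg.2 hγ0.le))).congr fun t => (hrec t).symm⟩
  obtain ⟨a, ha⟩ := hlim
  have ha0 : 0 ≤ a := ge_of_tendsto' ha hφ.nonneg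
  have hglim : Tendsto (fun t => (φ t ^ α) ^ q) atTop (𝓝 ((a ^ α) ^ q)) :=
    (ha.rpow_const (Or.inr hα.le)).rpow_const (Or.inr (by linarith))
  have hgat : IntegrableAtFilter (fun t => (φ t ^ α) ^ q) atTop volume :=
    ⟨Ici 0, Ici_mem_atTop 0, hg⟩
  have hzero := hgat.eq_zero_of_tendsto (fun s hs => by
    obtain ⟨b, hb⟩ := mem_atTop_sets.1 hs
    exact measure_mono_top (show Ici b ⊆ s from fun t ht => hb t ht) Real.volume_Ici) hglim
  rw [Real.rpow_eq_zero (Real.rpow_nonneg ha0 _) (by linarith), Real.rpow_eq_zero ha0 hα.ne'] at hzero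
  rwa [hzero] at ha

theorem memLp_and_eLpNorm_le {p : ℝ≥0∞} (hp : 1 ≤ p) (hp' : p ≠ ∞) (hd : MemLp d p mu)
    (h0 : φ 0 = 0) : MemLp (fun t => φ t ^ α) p mu ∧
      eLpNorm (fun t => φ t ^ α) p mu ≤ ENNReal.ofReal (L / c) * eLpNorm d p mu := by
  have hp0 : p ≠ 0 := (zero_lt_one.trans_le hp).ne'
  have hq : 1 ≤ p.toReal := by simpa using (ENNReal.toReal_le_toReal ENNReal.one_ne_top hp').2 hp
  have hLc : 0 ≤ L / c := (div_pos hL hc).le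
  obtain ⟨h1, h2⟩ := hφ.integrable_and_integral_le hα hc hL hq (hd.integrable_norm_rpow hp0 hp') h0
  have hnorm : ∀ t, ‖φ t ^ α‖ = φ t ^ α := fun t =>
    Real.norm_of_nonneg (Real.rpow_nonneg (hφ.nonneg t) _)
  have hmeas : AEStronglyMeasurable (fun t => φ t ^ α) mu :=
    (hφ.continuousOn_rpow hα.le).aestronglyMeasurable measurableSet_Ici
  have hmem : MemLp (fun t => φ t ^ α) p mu := by
    rw [← integrable_norm_rpow_iff hmeas hp0 hp']
    simpa only [hnorm] using h1
  refine ⟨hmem, ?_⟩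
  have hD0 : 0 ≤ ∫ t, |d t| ^ p.toReal ∂mu :=
    integral_nonneg fun t => Real.rpow_nonneg (abs_nonneg _) _
  rw [hmem.eLpNorm_eq_integral_rpow_norm hp0 hp', hd.eLpNorm_eq_integral_rpow_norm hp0 hp',
    ← ENNReal.ofReal_mul hLc]
  simp only [hnorm, Real.norm_eq_abs]
  refine ENNReal.ofReal_le_ofReal ?_
  calc (∫ t, (φ t ^ α) ^ p.toReal ∂mu) ^ p.toReal⁻¹
      ≤ ((L / c) ^ p.toReal * ∫ t, |d t| ^ p.toReal ∂mu) ^ p.toReal⁻¹ :=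
        Real.rpow_le_rpow (integral_nonneg fun t =>
          Real.rpow_nonneg (Real.rpow_nonneg (hφ.nonneg t) _) _) h2 (by positivity)
    _ = L / c * (∫ t, |d t| ^ p.toReal ∂mu) ^ p.toReal⁻¹ := by
        rw [Real.mul_rpow (Real.rpow_nonneg hLc _) hD0, ← Real.rpow_mul hLc,
          mul_inv_cancel₀ (by linarith), Real.rpow_one]

theorem memLp_top_and_eLpNorm_top_le {p : ℝ≥0∞} (hp : 1 ≤ p) (hp' : p ≠ ∞) (hd : MemLp d p mu)
    (h0 : φ 0 = 0) {β : ℝ} (hβ : β = α * (p.toReal - 1)) :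
    MemLp φ ∞ mu ∧ eLpNorm φ ∞ mu ≤
      ENNReal.ofReal ((L ^ p.toReal * (1 + β) / c ^ (p.toReal - 1)) ^ (1 / (1 + β))) *
        eLpNorm d p mu ^ (p.toReal / (1 + β)) := by
  have hp0 : p ≠ 0 := (zero_lt_one.trans_le hp).ne'
  have hq : 1 ≤ p.toReal := by simpa using (ENNReal.toReal_le_toReal ENNReal.one_ne_top hp').2 hp
  have hβ0 : 0 ≤ β := by rw [hβ]; exact mul_nonneg hα.le (by linarith)
  set q := p.toReal with hqdef
  set A := L ^ q * (1 + β) / c ^ (q - 1) with hA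
  have hA0 : 0 ≤ A := by positivity
  set D := ∫ t, |d t| ^ q ∂mu with hD
  have hD0 : 0 ≤ D := integral_nonneg fun t => Real.rpow_nonneg (abs_nonneg _) _
  have hbound : ∀ᵐ t ∂mu, ‖φ t‖ ≤ A ^ (1 / (1 + β)) * D ^ (1 / (1 + β)) := by
    filter_upwards [ae_restrict_mem measurableSet_Ici] with t ht
    have h := hφ.rpow_le hα hc hL hq (hd.integrable_norm_rpow hp0 hp') h0 ht
    rw [← hβ] at h
    have h' := Real.rpow_le_rpow (Real.rpow_nonneg (hφ.nonneg t) _) h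
      (by positivity : 0 ≤ 1 / (1 + β))
    rwa [← Real.rpow_mul (hφ.nonneg t), mul_one_div_cancel (by linarith), Real.rpow_one,
      Real.mul_rpow hA0 hD0, ← Real.norm_of_nonneg (hφ.nonneg t)] at h'
  refine ⟨memLp_top_of_bound (hφ.continuousOn.aestronglyMeasurable measurableSet_Ici) _ hbound, ?_⟩
  rw [eLpNorm_exponent_top, hd.eLpNorm_eq_integral_rpow_norm hp0 hp']
  refine (eLpNormEssSup_le_of_ae_bound hbound).trans (le_of_eq ?_)
  simp only [Real.norm_eq_abs, ← hqdef, ← hD]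
  rw [ENNReal.ofReal_rpow_of_nonneg (Real.rpow_nonneg hD0 _) (by positivity),
    ← Real.rpow_mul hD0, ← ENNReal.ofReal_mul (Real.rpow_nonneg hA0 _),
    show q⁻¹ * (q / (1 + β)) = 1 / (1 + β) by field_simp]

section bounded

variable {D : ℝ} (hd : ∀ᵐ t ∂mu, |d t| ≤ D)
include hd

omit hα hc hL in
-- Above the level (L/c) D + ε the derivative is at most -cε. The open interval allows the left
-- endpoint to lie below the level.
theorem sub_le_of_forall_ge (hα : 0 < α) (hc : 0 < c) (hL : 0 < L) {a b ε : ℝ} (ha : 0 ≤ a)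
    (hab : a ≤ b) (h : ∀ t ∈ Ioo a b, L / c * D + ε ≤ φ t ^ α) :
    φ b - φ a ≤ -(c * ε) * (b - a) := by
  have hint : IntervalIntegrable (fun t => -c * φ t ^ α + L * D) volume a b := by
    refine ContinuousOn.intervalIntegrable ?_
    rw [uIcc_of_le hab]
    exact ((continuousOn_const.mul (hφ.continuousOn_rpow hα.le)).add continuousOn_const).mono
      fun t ht => ha.trans ht.1
  have hder : ∀ᵐ t ∂mu, ∃ u', HasDerivAt φ u' t ∧ u' ≤ -c * φ t ^ α + L * D := by
    filter_upwards [hφ.deriv_le, hd] with t ⟨u', h1, h2⟩ h3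
    exact ⟨u', h1, h2.trans (by gcongr)⟩
  refine (sub_le_intervalIntegral hφ.ac hder ha hab hint).trans ?_
  calc ∫ t in a..b, (-c * φ t ^ α + L * D) ≤ ∫ _ in a..b, -(c * ε) := by
        refine intervalIntegral.integral_mono_on_of_le_Ioo hab hint (by simp) fun t ht => ?_
        have := mul_le_mul_of_nonneg_left (h t ht) hc.le
        rw [mul_add, ← mul_assoc, mul_div_cancel₀ _ hc.ne'] at this
        linarith
    _ = -(c * ε) * (b - a) := by
        rw [intervalIntegral.integral_const, smul_eq_mul, mul_comm]

theorem eventually_rpow_le {ε : ℝ} (hε : 0 < ε) :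
    ∀ᶠ t in atTop, φ t ^ α ≤ L / c * D + ε := by
  obtain ⟨a, ha, hφa⟩ : ∃ a, 0 ≤ a ∧ φ a ^ α ≤ L / c * D + ε := by
    by_contra! h
    -- Staying above the level until time (φ(0) + 1)/(cε) would force φ ≤ -1.
    have hcε : 0 < c * ε := mul_pos hc hε
    have hT : 0 ≤ (φ 0 + 1) / (c * ε) := div_nonneg (by linarith [hφ.nonneg 0]) hcε.le
    have h1 := hφ.sub_le_of_forall_ge hd hα hc hL le_rfl hT fun t ht => (h t ht.1.le).le
    rw [sub_zero, neg_mul, mul_div_cancel₀ _ hcε.ne'] at h1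
    linarith [hφ.nonneg ((φ 0 + 1) / (c * ε))]
  filter_upwards [eventually_ge_atTop a] with b hb
  have hcont : ContinuousOn (fun t => φ t ^ α) (Icc a b) :=
    (hφ.continuousOn_rpow hα.le).mono fun t ht => ha.trans ht.1
  -- `s` is the last time in [a, b] at or below the level; after it φ only decreases, so φ(b) ≤
  -- φ(s).
  obtain ⟨s, ⟨hs, hsφ⟩, hmax⟩ := (isCompact_Icc.of_isClosed_subset
    (hcont.preimage_isClosed_of_isClosed isClosed_Icc isClosed_Iic)
    inter_subset_left).exists_isGreatest ⟨a, ⟨le_rfl, hb⟩, show φ a ^ α ∈ Iic _ from hφa⟩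
  have h1 := hφ.sub_le_of_forall_ge hd hα hc hL (ha.trans hs.1) hs.2 (ε := ε) fun t ht => by
    by_contra! hlt
    exact ht.1.not_ge (hmax ⟨⟨hs.1.trans ht.1.le, ht.2.le⟩, hlt.le⟩)
  have h2 : φ b ≤ φ s := by
    have : 0 ≤ c * ε * (b - s) := mul_nonneg (mul_pos hc hε).le (by linarith [hs.2])
    linarith
  exact (Real.rpow_le_rpow (hφ.nonneg b) h2 hα.le).trans hsφ

end bounded

theorem limsup_le (hd : MemLp d ∞ mu) :
    limsup (fun s => ENNReal.ofReal (φ s ^ α)) atTop ≤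
      ENNReal.ofReal (L / c) * eLpNorm d ∞ mu := by
  have hfin : eLpNorm d ∞ mu ≠ ∞ := hd.eLpNorm_ne_top
  set D := (eLpNorm d ∞ mu).toReal with hD
  have hbound : ∀ᵐ t ∂mu, |d t| ≤ D := by
    filter_upwards [enorm_ae_le_eLpNormEssSup d mu] with t ht
    rw [← eLpNorm_exponent_top] at ht
    have := ENNReal.toReal_mono hfin ht
    rwa [toReal_enorm, Real.norm_eq_abs] at this
  have hM : 0 ≤ L / c * D := mul_nonneg (div_pos hL hc).le ENNReal.toReal_nonneg
  rw [← ENNReal.ofReal_toReal hfin, ← hD, ← ENNReal.ofReal_mul (div_pos hL hc).le]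
  refine ENNReal.le_of_forall_pos_le_add fun ε hε _ => ?_
  refine limsup_le_of_le (by isBoundedDefault) ?_
  filter_upwards [hφ.eventually_rpow_le hα hc hL hbound (NNReal.coe_pos.2 hε)] with t ht
  refine (ENNReal.ofReal_le_ofReal ht).trans (le_of_eq ?_)
  rw [ENNReal.ofReal_add hM ε.coe_nonneg, ENNReal.ofReal_coe_nnreal]

end IsDissipative

/-! ### From the Lyapunov function back to the state -/

theorem tendsto_zero_of_tendsto_V {n : ℕ} (hn : 2 ≤ n) {l : ℕ → ℝ}
    (hl : ∀ i, 1 ≤ i → i ≤ n → 0 < l i) {x : ℝ → Fin n → ℝ}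
    (h : Tendsto (fun t => V n l (x t)) atTop (𝓝 0)) : Tendsto x atTop (𝓝 0) := by
  obtain ⟨m, -, hm⟩ := exists_coord_bound hn hl
  refine tendsto_pi_nhds.2 fun i => ?_
  have hpos : 0 < wt n ((i : ℕ) + 1) / deg n := div_pos (wt_pos hn i.isLt) (deg_pos hn)
  have h1 := (h.div_const m).rpow_const (p := wt n ((i : ℕ) + 1) / deg n) (Or.inr hpos.le)
  rw [zero_div, Real.zero_rpow hpos.ne'] at h1
  exact squeeze_zero_norm (fun t => hm (x t) i) h1

end SignFeedback

open SignFeedback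
theorem theorem1 (n : ℕ) (hn : 2 ≤ n) :
    (∃ (l : ℕ → ℝ) (c : ℝ), Admissible n l c) ∧
    ∀ (l : ℕ → ℝ) (c : ℝ), Admissible n l c →
      ∀ p : ℝ≥0∞, 1 ≤ p → ∀ d : ℝ → ℝ, MemLp d p mu →
        ∀ x : ℝ → Fin n → ℝ, IsFilippovSolution (fun t => rhs n l (d t)) x →
          (p ≠ ∞ → x 0 = 0 →
            (MemLp (fun t => V n l (x t) ^ alpha n) p mu ∧
              eLpNorm (fun t => V n l (x t) ^ alpha n) p mu
                ≤ ENNReal.ofReal (2 * l n / c) * eLpNorm d p mu) ∧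
            (∀ β : ℝ, β = alpha n * (p.toReal - 1) →
              MemLp (fun t => V n l (x t)) ∞ mu ∧
              eLpNorm (fun t => V n l (x t)) ∞ mu
                ≤ ENNReal.ofReal
                    (((2 * l n) ^ p.toReal * (1 + β) / c ^ (p.toReal - 1)) ^ (1 / (1 + β)))
                  * eLpNorm d p mu ^ (p.toReal / (1 + β))) ∧
            Tendsto x atTop (𝓝 0)) ∧
          (p = ∞ →
            limsup (fun s => ENNReal.ofReal (V n l (x s) ^ alpha n)) atTop
              ≤ ENNReal.ofReal (2 * l n / c) * eLpNorm d ∞ mu) := by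
  refine ⟨exists_admissible hn, fun l c hA p hp d hd x hx => ?_⟩
  have hφ := hA.isDissipative hn hx
  have hα := alpha_pos hn
  have hc : 0 < c := hA.2.1
  have hL : 0 < 2 * l n := mul_pos two_pos (hA.1 n (by omega) le_rfl)
  refine ⟨fun hp' h0 => ?_, ?_⟩
  · have hV0 : V n l (x 0) = 0 := by rw [h0, V_zero hn]
    have hp0 : p ≠ 0 := (zero_lt_one.trans_le hp).ne'
    have hq : 1 ≤ p.toReal := by
      simpa using (ENNReal.toReal_le_toReal ENNReal.one_ne_top hp').2 hp
    exact ⟨hφ.memLp_and_eLpNorm_le hα hc hL hp hp' hd hV0,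
      fun β hβ => hφ.memLp_top_and_eLpNorm_top_le hα hc hL hp hp' hd hV0 hβ,
      tendsto_zero_of_tendsto_V hn hA.1
        (hφ.tendsto_zero hα hc hL hq (hd.integrable_norm_rpow hp0 hp') hV0)⟩
  · rintro rfl
    exact hφ.limsup_le hα hc hL hd
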